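/- Let $\Bbbk$ be an algebraically closed field of characteristic zero and let $G$ be a finite group. Let $F(G)$ be the algebra of $\Bbbk$-valued functions on $G$, with basis $\delta_h$ ($h\in G$). Let $\mathcal D(G)=\Bbbk[G]\otimes F(G)$ be the Drinfeld double, with product $$(g\otimes\delta_h)(g'\otimes\delta_{h'})=gg'\otimes\delta_{g'^{-1}hg'}\,\delta_{h'} .$$ For a finite-dimensional $\mathcal D(G)$-module $V$ put $V_g=\delta_gV$, so that $V=\bigoplus_{g\in G}V_g$. The category $\mathcal D(G)\text{-mod}$ of finite-dimensional modules is monoidal under the fibrewise tensor product $\overline\otimes$, given by $(V\,\overline\otimes\,W)_g=V_g\otimes_{\Bbbk}W_g$ with $G$ acting diagonally (its unit is $\bigoplus_{g\in G}\Bbbk_g$, with $(\overline{\mathbf 1})_g=\Bbbk$ for all $g$). Let $\mathcal D^{\mathrm{el}}(G)=\Bbbk[G]\otimes F(G)\otimes F(G)$ be the elliptic double, with product $$(g\otimes\delta_{h_1}\otimes\delta_{h_2})(g'\otimes\delta_{h_1'}\otimes\delta_{h_2'})=gg'\otimes\delta_{g'^{-1}h_1g'}\,\delta_{h_1'}\otimes\delta_{g'^{-1}h_2g'}\,\delta_{h_2'}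 .$$ Let $\Omega=\{(h,h')\in G\times G : hh'=h'h\}$, on which $G$ acts by simultaneous conjugation, let $\delta_\Omega=\sum_{(h,h')\in\Omega}1\otimes\delta_h\otimes\delta_{h'}$, a central idempotent, and let $\mathcal D_{\mathbf T^2}(G)=\mathcal D^{\mathrm{el}}(G)\cdot\delta_\Omega$, an algebra with unit $\delta_\Omega$. Then there is an equivalence of $\Bbbk$-linear abelian categories $$\mathcal Z\big((\mathcal D(G)\text{-mod},\overline\otimes)\big)\;\simeq\;\mathcal D_{\mathbf T^2}(G)\text{-mod}$$ between the Drinfeld center of $(\mathcal D(G)\text{-mod},\overline\otimes)$ and the category of finite-dimensional $\mathcal D_{\mathbf T^2}(G)$-modules. Moreover $\mathcal D_{\mathbf T^2}(G)\text{-mod}$ is equivalent, as a $\Bbbk$-linear category, to the category of $G$-equivariant bundles of finite-dimensional vector spaces over $\Omega$. -/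

import Mathlib

open CategoryTheory MonoidalCategory

universe u


noncomputable section

/-! ## Linear structure on the Drinfeld center, abelian categories -/

namespace CategoryTheory

namespace Center

variable {C : Type*} [Category* C] [Preadditive C] [MonoidalCategory C] [MonoidalPreadditive C]

/-- Morphisms of the Drinfeld center form an additive subgroup of the morphisms of `C`. -/
def homAddSubgroup (A B : Center C) : AddSubgroup (A.1 ⟶ B.1) where
  carrier := {f | ∀ U, (f ▷ U) ≫ (B.2.β U).hom = (A.2.β U).hom ≫ (U ◁ f)}
  zero_mem' U := by simp
  add_mem' {f g} hf hg U := by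
    simp only [Set.mem_ofPred_eq] at hf hg
    simp [hf U, hg U]
  neg_mem' {f} hf U := by
    simp only [Set.mem_ofPred_eq] at hf
    have h1 : (-f) ▷ U = -(f ▷ U) := (tensorRight U).map_neg
    have h2 : U ◁ (-f) = -(U ◁ f) := (tensorLeft U).map_neg
    simp [h1, h2, hf U]

/-- The bundled and unbundled descriptions of morphisms of the center. -/
def homEquiv (A B : Center C) : (A ⟶ B) ≃ homAddSubgroup A B where
  toFun f := ⟨f.f, f.comm⟩
  invFun f := { f := f.1, comm := f.2 }
  left_inv _ := rfl
  right_inv _ := rfl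

/-- The preadditive structure of the Drinfeld center: morphisms are added in `C`. -/
instance instPreadditiveCenter : Preadditive (Center C) where
  homGroup A B := (homEquiv A B).addCommGroup
  add_comp _ _ _ f g h := Center.ext _ _ (Preadditive.add_comp _ _ _ f.f g.f h.f)
  comp_add _ _ _ f g h := Center.ext _ _ (Preadditive.comp_add _ _ _ f.f g.f h.f)

variable {k : Type*} [Semiring k] [Linear k C] [MonoidalLinear k C]

/-- Morphisms of the Drinfeld center form a linear subspace of the morphisms of `C`. -/
def homSubmodule (A B : Center C) : Submodule k (A.1 ⟶ B.1) where
  __ := (homAddSubgroup A B).toAddSubmonoid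
  smul_mem' r f hf U := by
    have hf' : (f ▷ U) ≫ (B.2.β U).hom = (A.2.β U).hom ≫ (U ◁ f) := hf U
    simp [hf']

/-- The linear structure of the Drinfeld center: morphisms are scaled in `C`. -/
instance instLinearCenter : Linear k (Center C) where
  homModule A B :=
    letI e : (A ⟶ B) ≃+ homSubmodule (k := k) A B :=
      { toFun := fun f => ⟨f.f, f.comm⟩
        invFun := fun f => { f := f.1, comm := f.2 }
        left_inv := fun _ => rfl
        right_inv := fun _ => rfl
        map_add' := fun _ _ => rfl }
    e.module k
  smul_comp _ _ _ r f g := Center.ext _ _ (Linear.smul_comp _ _ _ r f.f g.f)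
  comp_smul _ _ _ f r g := Center.ext _ _ (Linear.comp_smul _ _ _ f.f r g.f)

end Center

/-- A preadditive category is abelian (with its given addition of morphisms). -/
def IsAbelianCategory (C : Type*) [Category* C] [P : Preadditive C] : Prop :=
  ∃ A : Abelian C, A.toPreadditive = P

end CategoryTheory

/-! ## The action algebra of a finite group acting on a set -/

/-- For a finite group `H` acting on a set `X`, the algebra `k[H] ⊗ F(X)`.
The function `a : H → X → k` stands for `∑ a h x • (h ⊗ δ_x)`, so that for finite `X` the elements
`h ⊗ δ_x` (see `ActionAlgebra.single`) form a basis; the product is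
`(h ⊗ δ_x) (h' ⊗ δ_x') = h h' ⊗ δ_{h'⁻¹ x} δ_x'` (see `ActionAlgebra.single_mul_single`). -/
def ActionAlgebra (k H X : Type*) := H → X → k

/-- The element of the action algebra with the given coefficients. -/
def ActionAlgebra.mk {k H X : Type*} (a : H → X → k) : ActionAlgebra k H X := a

namespace ActionAlgebra

variable {k H X : Type*} [Field k] [Group H] [Fintype H] [MulAction H X]

instance instAddCommGroup : AddCommGroup (ActionAlgebra k H X) := inferInstanceAs (AddCommGroup (H → X → k))
instance instModule : Module k (ActionAlgebra k H X) := inferInstanceAs (Module k (H → X → k))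

instance instFunLike : FunLike (ActionAlgebra k H X) H (X → k) where
  coe a := a
  coe_injective _ _ h := h

@[ext] theorem ext {a b : ActionAlgebra k H X} (h : ∀ g x, a g x = b g x) : a = b :=
  DFunLike.coe_injective (funext fun g => funext fun x => h g x)

@[simp] theorem add_apply (a b : ActionAlgebra k H X) (g : H) (x : X) :
    (a + b) g x = a g x + b g x := rfl
@[simp] theorem zero_apply (g : H) (x : X) : (0 : ActionAlgebra k H X) g x = 0 := rfl
@[simp] theorem smul_apply (r : k) (a : ActionAlgebra k H X) (g : H) (x : X) :
    (r • a) g x = r * a g x := rfl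

theorem sum_apply {ι : Type*} (s : Finset ι) (a : ι → ActionAlgebra k H X) (g : H) (x : X) :
    (∑ i ∈ s, a i) g x = ∑ i ∈ s, a i g x :=
  map_sum (AddMonoidHom.mk' (fun b : ActionAlgebra k H X => b g x) fun _ _ => rfl) a s

instance instMul : Mul (ActionAlgebra k H X) where
  mul a b := .mk fun g x => ∑ h : H, a (g * h⁻¹) (h • x) * b h x

theorem mul_apply (a b : ActionAlgebra k H X) (g : H) (x : X) :
    (a * b) g x = ∑ h : H, a (g * h⁻¹) (h • x) * b h x := rfl

open Classical in
/-- The element `e ⊗ f` for a function `f` on `X`. -/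
def ofFun (f : X → k) : ActionAlgebra k H X := .mk fun g x => if g = 1 then f x else 0


open Classical in
theorem ofFun_apply (f : X → k) (g : H) (x : X) :
    (ofFun f : ActionAlgebra k H X) g x = if g = 1 then f x else 0 := rfl

theorem ofFun_mul (f : X → k) (a : ActionAlgebra k H X) (g : H) (x : X) :
    (ofFun f * a : ActionAlgebra k H X) g x = f (g • x) * a g x := by
  classical
  rw [mul_apply, Finset.sum_eq_single g]
  · simp [ofFun_apply]
  · intro h _ hne
    have : g * h⁻¹ ≠ 1 := fun h1 => hne (mul_inv_eq_one.mp h1).symm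
    simp [ofFun_apply, this]
  · simp

theorem mul_ofFun (f : X → k) (a : ActionAlgebra k H X) (g : H) (x : X) :
    (a * ofFun f : ActionAlgebra k H X) g x = a g x * f x := by
  classical
  rw [mul_apply, Finset.sum_eq_single 1]
  · simp [ofFun_apply]
  · intro h _ hne
    simp [ofFun_apply, hne]
  · simp

/-- The unit is `e ⊗ δ_*`, where `δ_*` is the constant function `1`. -/
instance instOne : One (ActionAlgebra k H X) := ⟨ofFun fun _ => 1⟩

theorem one_def : (1 : ActionAlgebra k H X) = ofFun fun _ => 1 := rfl

instance instRing : Ring (ActionAlgebra k H X) where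
  __ := (inferInstance : AddCommGroup (ActionAlgebra k H X))
  mul := (· * ·)
  one := 1
  one_mul a := by ext g x; rw [one_def, ofFun_mul, one_mul]
  mul_one a := by ext g x; rw [one_def, mul_ofFun, mul_one]
  zero_mul a := by ext g x; simp [mul_apply]
  mul_zero a := by ext g x; simp [mul_apply]
  left_distrib a b c := by ext g x; simp [mul_apply, mul_add, Finset.sum_add_distrib]
  right_distrib a b c := by ext g x; simp [mul_apply, add_mul, Finset.sum_add_distrib]
  mul_assoc a b c := by
    ext g x
    simp only [mul_apply, Finset.sum_mul, Finset.mul_sum]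
    conv_rhs => rw [Finset.sum_comm]
    refine Finset.sum_congr rfl fun l _ => ?_
    conv_rhs => rw [← Equiv.sum_comp (Equiv.mulRight l)]
    refine Finset.sum_congr rfl fun m _ => ?_
    simp [mul_smul, mul_assoc]

instance instAlgebra : Algebra k (ActionAlgebra k H X) :=
  Algebra.ofModule
    (fun r a b => by ext g x; simp [mul_apply, Finset.mul_sum, mul_assoc])
    (fun r a b => by ext g x; simp [mul_apply, Finset.mul_sum, mul_left_comm])

open Classical in
/-- The basis element `h ⊗ δ_x`. -/
def single (h : H) (x : X) : ActionAlgebra k H X := .mk fun g y => if g = h ∧ y = x then 1 else 0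

open Classical in
theorem single_apply (h : H) (x : X) (g : H) (y : X) :
    (single h x : ActionAlgebra k H X) g y = if g = h ∧ y = x then 1 else 0 := rfl

open Classical in
/-- The product of basis elements: `(h ⊗ δ_x) (h' ⊗ δ_x') = h h' ⊗ δ_{h'⁻¹ x} δ_x'`. -/
theorem single_mul_single (h h' : H) (x x' : X) :
    (single h x * single h' x' : ActionAlgebra k H X) =
      if h'⁻¹ • x = x' then single (h * h') x' else 0 := by
  ext g y
  rw [mul_apply, Finset.sum_eq_single h']
  · by_cases hy : y = x'
    · subst hy
      by_cases hx : h'⁻¹ • x = y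
      · subst hx
        simp [single_apply, mul_inv_eq_iff_eq_mul]
      · have : ¬ (h' • y = x) := fun e => hx (by rw [← e, inv_smul_smul])
        simp [single_apply, hx, this]
    · split_ifs <;> simp [single_apply, hy]
  · intro l _ hl
    simp [single_apply, hl]
  · simp

theorem smul_single_smul {V : Type*} [AddCommGroup V] [Module (ActionAlgebra k H X) V]
    (h h' : H) (x y : X) (hy : h' • x = y) (v : V) :
    (single h y : ActionAlgebra k H X) • (single h' x : ActionAlgebra k H X) • v =
      (single (h * h') x : ActionAlgebra k H X) • v := by
  rw [smul_smul, single_mul_single, if_pos (by rw [← hy, inv_smul_smul])]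

theorem single_one_smul_of_ne {V : Type*} [AddCommGroup V] [Module (ActionAlgebra k H X) V]
    (h : H) (x y : X) (hy : y ≠ x) (v : V) :
    (single h y : ActionAlgebra k H X) • (single 1 x : ActionAlgebra k H X) • v = 0 := by
  rw [smul_smul, single_mul_single, if_neg (by simpa using hy), zero_smul]

theorem sum_single_one [Fintype X] : ∑ x, (single 1 x : ActionAlgebra k H X) = 1 := by
  classical
  ext g y
  rw [sum_apply]
  by_cases hg : g = 1 <;> simp [single_apply, one_def, ofFun_apply, hg]

theorem eq_sum_single [Fintype X] (a : ActionAlgebra k H X) :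
    a = ∑ h, ∑ x, a h x • single h x := by
  classical
  ext g y
  simp only [sum_apply]
  rw [Finset.sum_eq_single g, Finset.sum_eq_single y]
  · simp [single_apply]
  · intro z _ hz; simp [single_apply, hz.symm]
  · simp
  · intro z _ hz; simp [single_apply, hz.symm]
  · simp

instance instFinite [Finite X] : Module.Finite k (ActionAlgebra k H X) :=
  inferInstanceAs (Module.Finite k (H → X → k))

instance instIsNoetherianRing [Finite X] : IsNoetherianRing (ActionAlgebra k H X) :=
  IsNoetherianRing.of_finite k _

end ActionAlgebra

/-! ## Equivariant bundles and modules over the action algebra -/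

/-- The category of `H`-equivariant bundles of finite-dimensional vector spaces over an `H`-set `X`:
families of vector spaces `B x` with isomorphisms `B x ≅ B (h • x)`, compatible with the product
of `H`, that is, functors on the action groupoid, whose objects are the points of `X` and whose
morphisms `x ⟶ y` are the `h` in `H` with `h • x = y`. It carries the fibrewise tensor product. -/
abbrev EquivariantBundle (k H X : Type u) [Field k] [Group H] [MulAction H X] :=
  ActionCategory H X ⥤ FGModuleCat.{u} k

namespace ActionAlgebra

open scoped ModuleCat

/-- The point `x`, as an object of the action groupoid. -/
def pt (H : Type u) {X : Type u} [Group H] [MulAction H X] (x : X) : ActionCategory H X :=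
  ActionCategory.objEquiv H X x

/-- The morphism from `x` to `y = h • x` in the action groupoid. -/
def arrow {H X : Type u} [Group H] [MulAction H X] (h : H) {x y : X} (hy : h • x = y) :
    pt H x ⟶ pt H y := ⟨h, hy⟩

/-- The group element of a morphism in the action groupoid. -/
def label {H X : Type u} [Group H] [MulAction H X] {p q : ActionCategory H X} (f : p ⟶ q) : H := f.1

theorem label_smul {H X : Type u} [Group H] [MulAction H X] {p q : ActionCategory H X}
    (f : p ⟶ q) : label f • p.back = q.back := f.2

variable {k H X : Type u} [Field k] [Group H] [Fintype H] [MulAction H X]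

theorem smul_comm_scalar (V : FGModuleCat.{u} (ActionAlgebra k H X)) (a : ActionAlgebra k H X)
    (r : k) (v : V) : a • r • v = r • a • v := by
  have h : ∀ w : V, r • w = (algebraMap k (ActionAlgebra k H X) r) • w := fun w => rfl
  rw [h, h, smul_smul, smul_smul, Algebra.commutes]

/-- The fibre `V_x = δ_x V` of a module `V` over the action algebra. -/
def fiber (V : FGModuleCat.{u} (ActionAlgebra k H X)) (x : X) : Submodule k V where
  carrier := {v | (single 1 x : ActionAlgebra k H X) • v = v}
  zero_mem' := smul_zero _
  add_mem' {v w} hv hw := (smul_add _ v w).trans (congrArg₂ _ hv hw)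
  smul_mem' r v hv := (smul_comm_scalar V _ r v).trans (congrArg _ hv)

theorem mem_fiber {V : FGModuleCat.{u} (ActionAlgebra k H X)} {x : X} {v : V} :
    v ∈ fiber V x ↔ (single 1 x : ActionAlgebra k H X) • v = v := Iff.rfl

theorem single_smul_mem (V : FGModuleCat.{u} (ActionAlgebra k H X)) {h : H} {x y : X}
    (hy : h • x = y) (v : V) : (single h x : ActionAlgebra k H X) • v ∈ fiber V y := by
  rw [mem_fiber, smul_single_smul _ _ _ _ hy, one_mul]

theorem single_smul_of_mem {V : FGModuleCat.{u} (ActionAlgebra k H X)} {x : X} {v : V}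
    (hv : v ∈ fiber V x) (h : H) {y : X} (hy : y ≠ x) :
    (single h y : ActionAlgebra k H X) • v = 0 := by
  rw [← mem_fiber.1 hv, single_one_smul_of_ne _ _ _ hy]

theorem finite_scalar [Finite X] (V : FGModuleCat.{u} (ActionAlgebra k H X)) :
    Module.Finite k V := Module.Finite.trans (ActionAlgebra k H X) V

instance instFiniteFiber [Finite X] (V : FGModuleCat.{u} (ActionAlgebra k H X)) (x : X) :
    Module.Finite k (fiber V x) :=
  have := finite_scalar V
  inferInstance

/-- The action `v ↦ h v` from the fibre over `x` to the fibre over `h • x`. -/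
def fiberMap (V : FGModuleCat.{u} (ActionAlgebra k H X)) (h : H) {x y : X} (hy : h • x = y) :
    fiber V x →ₗ[k] fiber V y where
  toFun v := ⟨(single h x : ActionAlgebra k H X) • v.1, single_smul_mem V hy _⟩
  map_add' v w := Subtype.ext (smul_add _ v.1 w.1)
  map_smul' r v := Subtype.ext (smul_comm_scalar V _ r v.1)

/-- A morphism of modules preserves the fibres. -/
def fiberHom {V W : FGModuleCat.{u} (ActionAlgebra k H X)} (f : V ⟶ W) (x : X) :
    fiber V x →ₗ[k] fiber W x where
  toFun v := ⟨f.hom.hom v.1, by rw [mem_fiber, ← map_smul, mem_fiber.1 v.2]⟩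
  map_add' v w := Subtype.ext (map_add f.hom.hom v.1 w.1)
  map_smul' r v := Subtype.ext
    (map_smul f.hom.hom (algebraMap k (ActionAlgebra k H X) r) v.1)

variable (k H X)

/-- The bundle of the fibres of a module over the action algebra. -/
def toBundle [Finite X] :
    FGModuleCat.{u} (ActionAlgebra k H X) ⥤ EquivariantBundle k H X where
  obj V :=
    { obj := fun p => FGModuleCat.of k (fiber V p.back)
      map := fun {p q} f => FGModuleCat.ofHom (fiberMap V (label f) (label_smul f))
      map_id := fun p => by
        ext v
        exact mem_fiber.1 v.2
      map_comp := fun {p q r} f g => by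
        ext v
        exact (smul_single_smul _ _ _ _ (label_smul f) v.1).symm }
  map f := { app := fun p => FGModuleCat.ofHom (fiberHom f p.back)
             naturality := fun p q g => by
              ext v
              exact map_smul f.hom.hom _ v.1 }

variable {k H X}

/-- The space of sections of a bundle (for finite `X`, the direct sum of its fibres). -/
def Sections (B : EquivariantBundle k H X) : Type u := ∀ x : X, B.obj (pt H x)

instance instAddCommGroupSections (B : EquivariantBundle k H X) : AddCommGroup (Sections B) :=
  inferInstanceAs (AddCommGroup (∀ x : X, B.obj (pt H x)))

/-- The map `h : B x → B (h • x)` of a bundle. -/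
def bundleMap (B : EquivariantBundle k H X) (h : H) {x y : X} (hy : h • x = y) :
    B.obj (pt H x) →ₗ[k] B.obj (pt H y) :=
  (B.map (arrow h hy)).hom.hom

theorem bundleMap_one (B : EquivariantBundle k H X) {x : X} (hx : (1 : H) • x = x)
    (v : B.obj (pt H x)) : bundleMap B 1 hx v = v :=
  congrArg (fun f => f.hom.hom v) (B.map_id (pt H x))

theorem bundleMap_comp (B : EquivariantBundle k H X) {h h' : H} {x y z : X} (hy : h' • x = y)
    (hz : h • y = z) (hz' : (h * h') • x = z) (v : B.obj (pt H x)) :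
    bundleMap B h hz (bundleMap B h' hy v) = bundleMap B (h * h') hz' v :=
  (congrArg (fun f => f.hom.hom v) (B.map_comp (arrow h' hy) (arrow h hz))).symm

theorem bundleMap_congr (B : EquivariantBundle k H X) {h h' : H} {x x' y : X} (e : h = h')
    (hy : h • x = y) (hy' : h' • x' = y) (s : Sections B) :
    bundleMap B h hy (s x) = bundleMap B h' hy' (s x') := by
  subst e
  obtain rfl : x = x' := smul_left_cancel h (hy.trans hy'.symm)
  rfl

theorem bundleMap_hom {B B' : EquivariantBundle k H X} (f : B ⟶ B') {h : H} {x y : X}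
    (hy : h • x = y) (v : B.obj (pt H x)) :
    bundleMap B' h hy ((f.app (pt H x)).hom.hom v) =
      (f.app (pt H y)).hom.hom (bundleMap B h hy v) :=
  (congrArg (fun f => f.hom.hom v) (f.naturality (arrow h hy))).symm

/-- The action algebra acts on sections: `h ⊗ δ_x` sends `s` to the section supported at `h • x`
with value `h (s x)` there. -/
instance instSMulSections (B : EquivariantBundle k H X) : SMul (ActionAlgebra k H X) (Sections B) where
  smul a s := fun y => ∑ h : H, a h (h⁻¹ • y) • bundleMap B h (smul_inv_smul h y) (s (h⁻¹ • y))

theorem smul_section_apply (B : EquivariantBundle k H X) (a : ActionAlgebra k H X)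
    (s : Sections B) (y : X) :
    (a • s) y = ∑ h : H, a h (h⁻¹ • y) • bundleMap B h (smul_inv_smul h y) (s (h⁻¹ • y)) := rfl

theorem ofFun_smul_section (B : EquivariantBundle k H X) (f : X → k) (s : Sections B) (y : X) :
    ((ofFun f : ActionAlgebra k H X) • s) y = f y • s y := by
  classical
  rw [smul_section_apply, Finset.sum_eq_single 1]
  · rw [ofFun_apply, if_pos rfl, bundleMap_congr B rfl _ (one_smul H y) s, bundleMap_one, inv_one,
      one_smul]
  · intro h _ hh
    rw [ofFun_apply, if_neg hh, zero_smul]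
  · simp

theorem section_add_apply (B : EquivariantBundle k H X) (s t : Sections B) (y : X) :
    (s + t) y = s y + t y := rfl

instance instModuleSections (B : EquivariantBundle k H X) : Module (ActionAlgebra k H X) (Sections B) where
  one_smul s := funext fun y => by rw [one_def, ofFun_smul_section, one_smul]
  smul_zero a := funext fun y => by
    rw [smul_section_apply]
    exact Finset.sum_eq_zero fun h _ => (congrArg _ (map_zero _)).trans (smul_zero _)
  zero_smul s := funext fun y => by
    rw [smul_section_apply]
    exact Finset.sum_eq_zero fun h _ => zero_smul _ _
  smul_add a s t := funext fun y => by
    simp only [smul_section_apply, section_add_apply, map_add, smul_add, Finset.sum_add_distrib]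
  add_smul a b s := funext fun y => by
    simp only [smul_section_apply, section_add_apply, add_apply, add_smul,
      Finset.sum_add_distrib]
  mul_smul a b s := funext fun y => by
    simp only [smul_section_apply, mul_apply, Finset.sum_smul, map_sum, map_smul, Finset.smul_sum]
    rw [Finset.sum_comm' (t' := Finset.univ) (s' := fun _ => Finset.univ) (by simp)]
    conv_rhs => rw [Finset.sum_comm' (t' := Finset.univ) (s' := fun _ => Finset.univ) (by simp)]
    refine Finset.sum_congr rfl fun m _ => ?_
    conv_lhs => rw [← Equiv.sum_comp (Equiv.mulRight m)]
    refine Finset.sum_congr rfl fun l _ => ?_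
    have e : (l * m)⁻¹ • y = m⁻¹ • l⁻¹ • y := by rw [mul_inv_rev, mul_smul]
    have e' : (l * m) • m⁻¹ • l⁻¹ • y = y := by rw [mul_smul, smul_inv_smul, smul_inv_smul]
    have hs := bundleMap_congr B rfl (smul_inv_smul (l * m) y) e' s
    have hc : a (l * m * m⁻¹) (m • (l * m)⁻¹ • y) * b m ((l * m)⁻¹ • y) =
        a l (l⁻¹ • y) * b m (m⁻¹ • l⁻¹ • y) := by
      rw [e, smul_inv_smul, mul_inv_cancel_right]
    rw [bundleMap_comp B _ _ e']
    exact (congrArg₂ (fun (c : k) v => c • v) hc hs).trans (mul_smul _ _ _)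

theorem algebraMap_eq (r : k) :
    algebraMap k (ActionAlgebra k H X) r = ofFun fun _ => r := by
  ext g x
  rw [Algebra.algebraMap_eq_smul_one, one_def, smul_apply, ofFun_apply, ofFun_apply]
  split_ifs <;> simp

open Classical in
theorem single_eq_ofFun (x : X) :
    (single 1 x : ActionAlgebra k H X) = ofFun fun y => if y = x then 1 else 0 := by
  ext g y
  rw [single_apply, ofFun_apply]
  split_ifs <;> simp_all

theorem single_smul_section (B : EquivariantBundle k H X) (h : H) {x y : X} (hy : h • x = y)
    (s : Sections B) :
    ((single h x : ActionAlgebra k H X) • s) y = bundleMap B h hy (s x) := by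
  classical
  rw [smul_section_apply, Finset.sum_eq_single h]
  · rw [single_apply, if_pos ⟨rfl, by rw [← hy, inv_smul_smul]⟩, one_smul]
    exact bundleMap_congr B rfl _ _ s
  · intro l _ hl
    rw [single_apply, if_neg (fun hh => hl hh.1), zero_smul]
  · simp

theorem single_one_smul_section (B : EquivariantBundle k H X) (x : X) (s : Sections B) :
    ((single 1 x : ActionAlgebra k H X) • s) x = s x := by
  rw [single_eq_ofFun, ofFun_smul_section, if_pos rfl, one_smul]

theorem single_one_smul_section_ne (B : EquivariantBundle k H X) {x y : X} (hy : y ≠ x)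
    (s : Sections B) : ((single 1 x : ActionAlgebra k H X) • s) y = 0 := by
  rw [single_eq_ofFun, ofFun_smul_section, if_neg hy, zero_smul]

/-- Scalars act on sections pointwise. -/
theorem algebraMap_smul_section (B : EquivariantBundle k H X) (r : k) (s : Sections B) (y : X) :
    (algebraMap k (ActionAlgebra k H X) r • s) y = r • s y := by
  rw [algebraMap_eq, ofFun_smul_section]

instance instFiniteSections [Finite X] (B : EquivariantBundle k H X) :
    Module.Finite (ActionAlgebra k H X) (Sections B) := by
  let _ : Module k (Sections B) := Module.restrictScalars k (ActionAlgebra k H X) (Sections B)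
  have : IsScalarTower k (ActionAlgebra k H X) (Sections B) :=
    IsScalarTower.restrictScalars k (ActionAlgebra k H X) (Sections B)
  let e : Sections B ≃ₗ[k] (∀ x : X, B.obj (pt H x)) :=
    { toFun := fun s => s
      invFun := fun s => s
      map_add' := fun _ _ => rfl
      map_smul' := fun r s => funext fun y => algebraMap_smul_section B r s y
      left_inv := fun _ => rfl
      right_inv := fun _ => rfl }
  have : Module.Finite k (Sections B) := Module.Finite.equiv e.symm
  exact Module.Finite.of_restrictScalars_finite k (ActionAlgebra k H X) (Sections B)

variable (k H X)

/-- The module of sections of a bundle. -/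
def ofBundle [Finite X] : EquivariantBundle k H X ⥤ FGModuleCat.{u} (ActionAlgebra k H X) where
  obj B := FGModuleCat.of _ (Sections B)
  map {B B'} f := FGModuleCat.ofHom
    { toFun := fun s x => (f.app (pt H x)).hom.hom (s x)
      map_add' := fun s t => funext fun x => map_add _ (s x) (t x)
      map_smul' := fun a s => funext fun x => by
        refine (map_sum (f.app (pt H x)).hom.hom _ _).trans (Finset.sum_congr rfl fun h _ => ?_)
        exact (map_smul _ _ _).trans (congrArg _ (bundleMap_hom f _ _).symm) }

open Classical in
/-- The section supported at `x` with value `v` there. -/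
def singleSection (B : EquivariantBundle k H X) (x : X) (v : B.obj (pt H x)) : Sections B :=
  Pi.single (M := fun x => B.obj (pt H x)) x v

theorem singleSection_same (B : EquivariantBundle k H X) (x : X) (v : B.obj (pt H x)) :
    singleSection k H X B x v x = v := by
  classical exact Pi.single_eq_same (M := fun x => B.obj (pt H x)) x v

theorem singleSection_ne (B : EquivariantBundle k H X) {x y : X} (hy : y ≠ x)
    (v : B.obj (pt H x)) : singleSection k H X B x v y = 0 := by
  classical exact Pi.single_eq_of_ne (M := fun x => B.obj (pt H x)) hy v

theorem singleSection_mem [Finite X] (B : EquivariantBundle k H X) (x : X) (v : B.obj (pt H x)) :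
    (singleSection k H X B x v : (ofBundle k H X).obj B) ∈ fiber ((ofBundle k H X).obj B) x :=
  funext fun y => by
    by_cases hy : y = x
    · subst hy
      exact single_one_smul_section B y _
    · exact (single_one_smul_section_ne B hy _).trans (singleSection_ne k H X B hy v).symm

/-- The fibre of the module of sections over `x` is the fibre of the bundle over `x`. -/
def fiberSections [Finite X] (B : EquivariantBundle k H X) (x : X) :
    fiber ((ofBundle k H X).obj B) x ≃ₗ[k] B.obj (pt H x) where
  toFun s := (show Sections B from s.1) x
  map_add' _ _ := rfl
  map_smul' r s := algebraMap_smul_section B r s.1 x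
  invFun v := ⟨singleSection k H X B x v, singleSection_mem k H X B x v⟩
  left_inv s := by
    refine Subtype.ext (funext fun y => ?_)
    by_cases hy : y = x
    · subst hy
      exact singleSection_same k H X B y _
    · refine (singleSection_ne k H X B hy _).trans ?_
      have h := single_one_smul_section_ne B hy s.1
      exact h.symm.trans (congrFun (mem_fiber.1 s.2) y)
  right_inv v := singleSection_same k H X B x v

variable {H X} in
theorem single_one_mul (x : X) (a : ActionAlgebra k H X) :
    single 1 x * a = ∑ h, a h (h⁻¹ • x) • (single h (h⁻¹ • x) : ActionAlgebra k H X) := by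
  classical
  ext g y
  rw [single_eq_ofFun, ofFun_mul, sum_apply, Finset.sum_eq_single g]
  · rw [smul_apply, single_apply]
    by_cases e : g • y = x
    · subst e; simp
    · have : ¬ y = g⁻¹ • x := fun h => e (by rw [h, smul_inv_smul])
      simp [e, this]
  · intro h _ hh
    rw [smul_apply, single_apply, if_neg (fun e => hh e.1.symm), mul_zero]
  · simp

/-- A module is the space of sections of the bundle of its fibres. -/
def sectionsFiber [Fintype X] (V : FGModuleCat.{u} (ActionAlgebra k H X)) :
    V ≃ₗ[ActionAlgebra k H X] Sections ((toBundle k H X).obj V) where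
  toFun v := fun x => ⟨(single 1 x : ActionAlgebra k H X) • v,
    single_smul_mem V (one_smul H x) v⟩
  map_add' v w := funext fun x => Subtype.ext (smul_add _ v w)
  map_smul' a v := funext fun x => Subtype.ext <| by
    refine Eq.trans ?_ (Submodule.coe_sum (fiber V x) _ _).symm
    refine (smul_smul _ _ _).trans ?_
    rw [single_one_mul, Finset.sum_smul]
    refine Finset.sum_congr rfl fun h _ => ?_
    refine (smul_assoc _ _ _).trans (congrArg _ ?_)
    exact ((smul_single_smul _ _ _ _ (one_smul _ _) _).trans (by rw [mul_one]; rfl)).symm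
  invFun s := ∑ x, ((show fiber V x from s x) : V)
  left_inv v := (Finset.sum_smul).symm.trans (by rw [sum_single_one, one_smul])
  right_inv s := funext fun x => Subtype.ext <| by
    refine Finset.smul_sum.trans ((Finset.sum_eq_single x ?_ (by simp)).trans ?_)
    · intro y _ hy
      exact single_smul_of_mem (show fiber V y from s y).2 _ hy.symm
    · exact (show fiber V x from s x).2

/-- The fibres of the module of sections of a bundle form the given bundle. -/
def fiberSectionsIso [Finite X] : ofBundle k H X ⋙ toBundle k H X ≅ 𝟭 _ :=
  NatIso.ofComponents
    (fun B => NatIso.ofComponents (fun p => (fiberSections k H X B p.back).toFGModuleCatIso)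
      (fun {p q} f => by
        ext s
        exact single_smul_section B (label f) (label_smul f) s.1))
    (fun {B B'} f => by
      ext p s
      rfl)

/-- A module is the module of sections of the bundle of its fibres, naturally. -/
def sectionsFiberIso [Fintype X] : 𝟭 _ ≅ toBundle k H X ⋙ ofBundle k H X :=
  NatIso.ofComponents (fun V => (sectionsFiber k H X V).toFGModuleCatIso)
    (fun {V W} f => by
      ext v
      exact funext fun x => Subtype.ext (map_smul f.hom.hom _ v).symm)

/-- Equivariant bundles are the same as modules over the action algebra: a bundle corresponds to
the module of its sections, a module to the bundle of its fibres. -/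
def bundleEquivalence [Fintype X] :
    EquivariantBundle k H X ≌ FGModuleCat.{u} (ActionAlgebra k H X) where
  functor := ofBundle k H X
  inverse := toBundle k H X
  unitIso := (fiberSectionsIso k H X).symm
  counitIso := (sectionsFiberIso k H X).symm
  functor_unitIso_comp B := by
    refine (Iso.comp_inv_eq ((sectionsFiberIso k H X).app _)).2 ?_
    rw [Category.id_comp]
    ext s
    refine funext fun x => ?_
    refine (fiberSections k H X B x).injective ?_
    refine ((fiberSections k H X B x).apply_symm_apply _).trans ?_
    exact (single_one_smul_section B x s).symm

/-! ## The fibrewise tensor product -/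

/-- The fibrewise tensor product of finite-dimensional modules over the action algebra:
`(V ⊗ W)_x = V_x ⊗ W_x` with `H` acting diagonally (see `tensorObj_carrier`, `single_smul_tensor`),
with the usual associator and unitors of vector spaces in each fibre. -/
instance fiberwiseMonoidal [Fintype X] : MonoidalCategory (FGModuleCat.{u} (ActionAlgebra k H X)) :=
  Monoidal.transport (bundleEquivalence k H X)

variable {k H X}

theorem tensorObj_carrier [Fintype X] (V W : FGModuleCat.{u} (ActionAlgebra k H X)) :
    ((V ⊗ W : FGModuleCat.{u} (ActionAlgebra k H X)) : Type u) =
      ∀ x : X, TensorProduct k (fiber V x) (fiber W x) := rfl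

theorem tensorUnit_carrier [Fintype X] :
    ((𝟙_ (FGModuleCat.{u} (ActionAlgebra k H X)) : FGModuleCat.{u} (ActionAlgebra k H X)) : Type u)
      = (X → k) := rfl

theorem single_smul_unit [Fintype X] (h : H) {x y : X} (hy : h • x = y)
    (s : (𝟙_ (FGModuleCat.{u} (ActionAlgebra k H X)) : FGModuleCat.{u} (ActionAlgebra k H X))) :
    (show X → k from (single h x : ActionAlgebra k H X) • s) y = (show X → k from s) x :=
  single_smul_section _ h hy s

open TensorProduct in
theorem single_smul_tensor [Fintype X] (V W : FGModuleCat.{u} (ActionAlgebra k H X)) (h : H)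
    {x y : X} (hy : h • x = y) (s : (V ⊗ W : FGModuleCat.{u} (ActionAlgebra k H X)))
    (v : fiber V x) (w : fiber W x)
    (hs : (show ∀ x : X, TensorProduct k (fiber V x) (fiber W x) from s) x = v ⊗ₜ[k] w) :
    (show ∀ x : X, TensorProduct k (fiber V x) (fiber W x) from
      (single h x : ActionAlgebra k H X) • s) y = fiberMap V h hy v ⊗ₜ[k] fiberMap W h hy w := by
  refine (single_smul_section _ h hy s).trans ?_
  refine (congrArg _ hs).trans ?_
  rfl

instance instMonoidalPreadditiveBundle : MonoidalPreadditive (EquivariantBundle k H X) where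
  whiskerLeft_zero := by intros; ext : 2; simp; rfl
  zero_whiskerRight := by intros; ext : 2; simp; rfl
  whiskerLeft_add := by intros; ext : 2; simp; rfl
  add_whiskerRight := by intros; ext : 2; simp; rfl

instance instMonoidalLinearBundle : MonoidalLinear k (EquivariantBundle k H X) where
  whiskerLeft_smul := by intros; ext : 2; simp; rfl
  smul_whiskerRight := by intros; ext : 2; simp; rfl

instance instAdditiveToBundle [Finite X] : (toBundle k H X).Additive where
  map_add := by intros; rfl

instance instLinearToBundle [Finite X] : (toBundle k H X).Linear k where
  map_smul := by intros; rfl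

instance instMonoidalToBundle [Fintype X] : (toBundle k H X).Monoidal :=
  inferInstanceAs (Monoidal.equivalenceTransported (bundleEquivalence k H X)).inverse.Monoidal

instance instIsEquivalenceToBundle [Fintype X] : (toBundle k H X).IsEquivalence :=
  inferInstanceAs (bundleEquivalence k H X).inverse.IsEquivalence

instance instMonoidalPreadditive [Fintype X] : MonoidalPreadditive (FGModuleCat.{u} (ActionAlgebra k H X)) :=
  monoidalPreadditive_of_faithful (toBundle k H X)

instance instMonoidalLinear [Fintype X] : MonoidalLinear k (FGModuleCat.{u} (ActionAlgebra k H X)) :=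
  MonoidalLinear.ofFaithful k (toBundle k H X)

end ActionAlgebra

/-! ## The Drinfeld double and the algebra of the torus -/

section Double

variable (k G : Type u) [Field k] [Group G] [Fintype G]

/-- The action of `G` on itself by conjugation. -/
instance conjAction : MulAction (ConjAct G) G := MulDistribMulAction.toMulAction

/-- The action of `G` on pairs by simultaneous conjugation. -/
instance conjActionPairs : MulAction (ConjAct G) (G × G) := Prod.mulAction

theorem conjAction_def (g h : G) : ConjAct.toConjAct g • h = g * h * g⁻¹ := rfl

theorem conjActionPairs_def (g : G) (p : G × G) :
    ConjAct.toConjAct g • p = (g * p.1 * g⁻¹, g * p.2 * g⁻¹) := rfl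

/-- The Drinfeld double `D(G) = k[G] ⊗ F(G)`, the action algebra of `G` acting on itself by
conjugation; its modules are the `G`-equivariant bundles over `G`. -/
abbrev DrinfeldDouble := ActionAlgebra k (ConjAct G) G

/-- The elliptic double `k[G] ⊗ F(G) ⊗ F(G)`, the action algebra of `G` acting on `G × G` by
simultaneous conjugation. -/
abbrev EllipticDouble := ActionAlgebra k (ConjAct G) (G × G)

/-- The conjugation-invariant set `Ω` of commuting pairs in `G × G`. -/
def CommutingPairs (G : Type u) [Group G] : SubMulAction (ConjAct G) (G × G) where
  carrier := {p | p.1 * p.2 = p.2 * p.1}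
  smul_mem' g p hp :=
    (smul_mul' g p.1 p.2).symm.trans ((congrArg (g • ·) hp).trans (smul_mul' g p.2 p.1))

/-- The action of `G` on commuting pairs by simultaneous conjugation. -/
instance conjActionCommutingPairs : MulAction (ConjAct G) (CommutingPairs G) :=
  SubMulAction.mulAction (CommutingPairs G)

theorem conjActionCommutingPairs_def (g : ConjAct G) (p : CommutingPairs G) :
    ((g • p : CommutingPairs G) : G × G) = g • (p : G × G) := rfl

variable {G} in
theorem smul_mem_commutingPairs (g : ConjAct G) (p : G × G) :
    g • p ∈ CommutingPairs G ↔ p ∈ CommutingPairs G :=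
  ⟨fun h => inv_smul_smul g p ▸ (CommutingPairs G).smul_mem g⁻¹ h,
    (CommutingPairs G).smul_mem g⟩

open Classical in
/-- The idempotent `δ_Ω = ∑_{(h, h') ∈ Ω} δ_{(h, h')}` of the elliptic double. -/
def deltaOmega : EllipticDouble k G :=
  ∑ p : CommutingPairs G, ActionAlgebra.single 1 (p : G × G)

open Classical in
theorem deltaOmega_eq :
    deltaOmega k G = ActionAlgebra.ofFun fun p => if p ∈ CommutingPairs G then 1 else 0 := by
  ext g p
  rw [deltaOmega, ActionAlgebra.sum_apply, ActionAlgebra.ofFun_apply]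
  by_cases hp : p ∈ CommutingPairs G
  · rw [Finset.sum_eq_single ⟨p, hp⟩]
    · simp [ActionAlgebra.single_apply, hp]
    · intro q _ hq
      rw [ActionAlgebra.single_apply, if_neg]
      exact fun h => hq (Subtype.ext h.2.symm)
    · simp
  · rw [Finset.sum_eq_zero]
    · simp [hp]
    · intro q _
      rw [ActionAlgebra.single_apply, if_neg]
      exact fun h => hp (h.2 ▸ q.2)

theorem deltaOmega_comm (a : EllipticDouble k G) : deltaOmega k G * a = a * deltaOmega k G := by
  classical
  ext g p
  rw [deltaOmega_eq, ActionAlgebra.ofFun_mul, ActionAlgebra.mul_ofFun, mul_comm]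
  exact congrArg (a g p * ·) (if_congr (smul_mem_commutingPairs g p) rfl rfl)

theorem deltaOmega_mul_self : deltaOmega k G * deltaOmega k G = deltaOmega k G := by
  classical
  ext g p
  conv_lhs => rw [deltaOmega_eq, ActionAlgebra.mul_ofFun]
  rw [deltaOmega_eq, ActionAlgebra.ofFun_apply]
  split_ifs <;> simp

/-- The algebra `D_{T²}(G) = D^el(G) · δ_Ω`, as a subspace of the elliptic double that is closed
under multiplication; it is spanned by the `g ⊗ δ_{(h, h')}` with `(h, h')` in `Ω`, and its unit
is `δ_Ω`. -/
def torusSubalgebra : NonUnitalSubalgebra k (EllipticDouble k G) where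
  carrier := {b | ∃ a, b = a * deltaOmega k G}
  zero_mem' := ⟨0, (zero_mul _).symm⟩
  add_mem' := by
    rintro _ _ ⟨a, rfl⟩ ⟨b, rfl⟩
    exact ⟨a + b, (add_mul _ _ _).symm⟩
  mul_mem' := by
    rintro _ _ ⟨a, rfl⟩ ⟨b, rfl⟩
    exact ⟨a * deltaOmega k G * b, (mul_assoc _ _ _).symm⟩
  smul_mem' := by
    rintro r _ ⟨a, rfl⟩
    exact ⟨r • a, (smul_mul_assoc r a _).symm⟩

/-- The algebra `D_{T²}(G)`. -/
abbrev TorusDouble := torusSubalgebra k G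

theorem mul_deltaOmega_of_mem {b : EllipticDouble k G} (hb : b ∈ torusSubalgebra k G) :
    b * deltaOmega k G = b := by
  obtain ⟨a, rfl⟩ := hb
  rw [mul_assoc, deltaOmega_mul_self]

instance instOneTorusDouble : One (TorusDouble k G) := ⟨⟨deltaOmega k G, 1, (one_mul _).symm⟩⟩

instance instRingTorusDouble : Ring (TorusDouble k G) where
  __ := (inferInstance : NonUnitalRing (TorusDouble k G))
  one := 1
  one_mul b := Subtype.ext <|
    (deltaOmega_comm k G b.1).trans (mul_deltaOmega_of_mem k G b.2)
  mul_one b := Subtype.ext (mul_deltaOmega_of_mem k G b.2)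

instance instAlgebraTorusDouble : Algebra k (TorusDouble k G) :=
  Algebra.ofModule (fun r a b => smul_mul_assoc r a b) (fun r a b => mul_smul_comm r a b)

end Double

end

/-! Modules over the Drinfeld double are bundles on the action groupoid of the conjugation action,
and the center is invariant under monoidal equivalence, so it suffices to compute the center of the
category of bundles on a groupoid `𝒢` with finite sets of morphisms. A half-braiding on a bundle `V`
is determined by its components at the bundles spanned by the morphisms out of the objects `x`,
since by naturality every other component is read off from these. There it amounts to a map from
`V x` to the `V x`-valued functions on the loops at `x`, and the hexagon axiom makes this map a
coaction of the coalgebra spanned by the loops, that is, a grading of `V x` by the loops. Graded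
bundles are the bundles on the inertia groupoid of `𝒢`, whose objects are the loops of `𝒢`; for the
conjugation action of `G` these loops are the commuting pairs. -/

noncomputable section

open TensorProduct DirectSum

section FunctorCategory

variable {C D : Type*} [Category* C] [Category* D] [Preadditive D] [MonoidalCategory D]
  [MonoidalPreadditive D]

instance monoidalPreadditive_functor : MonoidalPreadditive (C ⥤ D) where
  whiskerLeft_zero := by intros; ext; exact MonoidalPreadditive.whiskerLeft_zero
  zero_whiskerRight := by intros; ext; exact MonoidalPreadditive.zero_whiskerRight
  whiskerLeft_add _ _ := by ext; exact MonoidalPreadditive.whiskerLeft_add _ _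
  add_whiskerRight _ _ := by ext; exact MonoidalPreadditive.add_whiskerRight _ _

instance monoidalLinear_functor (k : Type*) [Semiring k] [Linear k D] [MonoidalLinear k D] :
    MonoidalLinear k (C ⥤ D) where
  whiskerLeft_smul _ _ _ _ _ := by ext; exact MonoidalLinear.whiskerLeft_smul _ _ _
  smul_whiskerRight _ _ _ _ _ := by ext; exact MonoidalLinear.smul_whiskerRight _ _ _

end FunctorCategory

section TwistedComm

variable {R ι N : Type*} {M : ι → Type*} [CommRing R] [DecidableEq ι] [∀ i, AddCommGroup (M i)]
  [∀ i, Module R (M i)] [AddCommGroup N] [Module R N]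

/-- The symmetry `(⨁ i, M i) ⊗ N ≃ N ⊗ ⨁ i, M i`, twisted on the `i`-th summand by the
automorphism `a i` of `N`. -/
def twistedComm (a : ι → N ≃ₗ[R] N) : (⨁ i, M i) ⊗[R] N ≃ₗ[R] N ⊗[R] ⨁ i, M i :=
  TensorProduct.directSumLeft R R M N ≪≫ₗ
    DFinsupp.mapRange.linearEquiv (fun i => TensorProduct.comm R (M i) N ≪≫ₗ
      TensorProduct.congr (a i) (LinearEquiv.refl R (M i))) ≪≫ₗ
    (TensorProduct.directSumRight R R N M).symm

@[simp] theorem twistedComm_lof_tmul (a : ι → N ≃ₗ[R] N) (i : ι) (m : M i) (n : N) :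
    twistedComm a (lof R ι M i m ⊗ₜ[R] n) = a i n ⊗ₜ[R] lof R ι M i m := by
  rw [twistedComm, LinearEquiv.trans_apply, LinearEquiv.trans_apply,
    TensorProduct.directSumLeft_tmul_lof]
  refine (congrArg _ (lmap_lof (fun i => (TensorProduct.comm R (M i) N ≪≫ₗ
      TensorProduct.congr (a i) (LinearEquiv.refl R (M i))).toLinearMap) i (m ⊗ₜ[R] n))).trans ?_
  exact TensorProduct.directSumRight_symm_lof_tmul (R := R) (S := R) _ i m

end TwistedComm

/-! ### Half-braidings on bundles over a groupoid -/

theorem sum_single_apply_of_injective {ι κ M N : Type*} [Zero M] [AddCommMonoid N] {σ : ι → κ}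
    (hσ : σ.Injective) {F : ι → M → N} (hF : ∀ i, F i 0 = 0) (c : ι →₀ M) (i : ι) :
    (c.sum fun j m => Finsupp.single (σ j) (F j m)) (σ i) = F i (c i) := by
  rw [Finsupp.sum_apply, Finsupp.sum_eq_single i]
  · exact Finsupp.single_eq_same
  · exact fun j _ hj => Finsupp.single_eq_of_ne (hσ.ne hj.symm)
  · exact fun _ => by rw [hF, Finsupp.single_zero, Finsupp.coe_zero, Pi.zero_apply]

/-- The category of bundles of finitely generated modules over a groupoid `𝒢`. -/
abbrev GroupoidBundle (k 𝒢 : Type u) [CommRing k] [Groupoid.{u} 𝒢] := 𝒢 ⥤ FGModuleCat.{u} k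

namespace GroupoidBundle

variable {k 𝒢 : Type u} [CommRing k] [Groupoid.{u} 𝒢]

/-- The action of a morphism of the groupoid on the fibres of a bundle. -/
def transport (V : GroupoidBundle k 𝒢) {x y : 𝒢} (f : x ⟶ y) : V.obj x →ₗ[k] V.obj y :=
  (V.map f).hom.hom

@[simp] theorem transport_id (V : GroupoidBundle k 𝒢) (x : 𝒢) (v : V.obj x) :
    transport V (𝟙 x) v = v :=
  congrArg (fun f => f.hom.hom v) (V.map_id x)

theorem transport_comp (V : GroupoidBundle k 𝒢) {x y z : 𝒢} (f : x ⟶ y) (g : y ⟶ z)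
    (v : V.obj x) : transport V (f ≫ g) v = transport V g (transport V f v) :=
  congrArg (fun f => f.hom.hom v) (V.map_comp f g)

theorem transport_tmul (V W : GroupoidBundle k 𝒢) {x y : 𝒢} (f : x ⟶ y) (v : V.obj x)
    (w : W.obj x) :
    transport (V ⊗ W) f (v ⊗ₜ[k] w) = transport V f v ⊗ₜ[k] transport W f w := rfl

/-- The map on fibres induced by a morphism of bundles. -/
def fibreMap {V W : GroupoidBundle k 𝒢} (φ : V ⟶ W) (x : 𝒢) : V.obj x →ₗ[k] W.obj x :=
  (φ.app x).hom.hom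

theorem hom_ext {V W : GroupoidBundle k 𝒢} {φ ψ : V ⟶ W}
    (h : ∀ x v, fibreMap φ x v = fibreMap ψ x v) : φ = ψ := by
  ext x v
  exact h x v

theorem fibreMap_transport {V W : GroupoidBundle k 𝒢} (φ : V ⟶ W) {x y : 𝒢} (f : x ⟶ y)
    (v : V.obj x) : fibreMap φ y (transport V f v) = transport W f (fibreMap φ x v) :=
  congrArg (fun f => f.hom.hom v) (φ.naturality f)

section Regular

variable [∀ x y : 𝒢, Finite (x ⟶ y)]

/-- The regular bundle at `x`: its fibres are free on the morphisms out of `x`. -/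
def regular (x : 𝒢) : GroupoidBundle k 𝒢 where
  obj y := FGModuleCat.of k ((x ⟶ y) →₀ k)
  map f := FGModuleCat.ofHom (Finsupp.lmapDomain k k (· ≫ f))
  map_id y := FGModuleCat.hom_ext <| Finsupp.lhom_ext fun h r =>
    Finsupp.mapDomain_single.trans (congrArg (Finsupp.single · r) (Category.comp_id h))
  map_comp f g := FGModuleCat.hom_ext <| Finsupp.lhom_ext fun h r => by
    refine Eq.trans ?_ (congrArg (Finsupp.mapDomain (· ≫ g)) Finsupp.mapDomain_single.symm)
    rw [Finsupp.mapDomain_single, Category.assoc]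
    exact Finsupp.mapDomain_single

/-- The basis vector of the regular bundle given by a morphism. -/
def basisVector {x y : 𝒢} (f : x ⟶ y) : (regular x : GroupoidBundle k 𝒢).obj y :=
  (Finsupp.single f 1 : (x ⟶ y) →₀ k)

/-- The morphism from the regular bundle at `x` given by a vector in the fibre at `x`. -/
def regularLift {U : GroupoidBundle k 𝒢} {x : 𝒢} (u : U.obj x) : regular x ⟶ U where
  app y := FGModuleCat.ofHom (Finsupp.linearCombination k fun f : x ⟶ y => transport U f u)
  naturality y z f := FGModuleCat.hom_ext <| Finsupp.lhom_ext fun (h : x ⟶ y) (r : k) => by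
    refine (congrArg (Finsupp.linearCombination k fun f : x ⟶ z => transport U f u)
      Finsupp.mapDomain_single).trans ?_
    refine (Finsupp.linearCombination_single k r (h ≫ f)).trans ?_
    refine Eq.trans ?_ (congrArg (transport U f) (Finsupp.linearCombination_single k r h).symm)
    rw [transport_comp, map_smul]

theorem fibreMap_regularLift {U : GroupoidBundle k 𝒢} {x y : 𝒢} (u : U.obj x) (f : x ⟶ y) :
    fibreMap (regularLift u) y (basisVector f) = transport U f u :=
  (Finsupp.linearCombination_single k (1 : k) f).trans (one_smul k _)

open scoped Classical in
/-- Coordinates, with respect to the basis of the regular bundle, of tensors in its fibres. -/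
def regularTensorEquiv (x y : 𝒢) (M : Type*) [AddCommGroup M] [Module k M] :
    (regular x : GroupoidBundle k 𝒢).obj y ⊗[k] M ≃ₗ[k] (x ⟶ y) →₀ M :=
  TensorProduct.finsuppScalarLeft k M (x ⟶ y)

theorem regularTensorEquiv_symm_single {x y : 𝒢} (f : x ⟶ y) {M : Type*} [AddCommGroup M]
    [Module k M] (m : M) :
    (regularTensorEquiv x y M).symm (Finsupp.single f m) = basisVector (k := k) f ⊗ₜ m := by
  classical exact finsuppScalarLeft_symm_apply_single f m

theorem regularTensorEquiv_basisVector {x y : 𝒢} (f : x ⟶ y) {M : Type*} [AddCommGroup M]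
    [Module k M] (m : M) :
    regularTensorEquiv x y M (basisVector (k := k) f ⊗ₜ m) = Finsupp.single f m := by
  rw [← regularTensorEquiv_symm_single, LinearEquiv.apply_symm_apply]

theorem regularTensorEquiv_symm_apply {x y : 𝒢} {M : Type*} [AddCommGroup M]
    [Module k M] (c : (x ⟶ y) →₀ M) :
    (regularTensorEquiv x y M).symm c = c.sum fun f m => basisVector (k := k) f ⊗ₜ m := by
  conv_lhs => rw [← c.sum_single, map_finsuppSum]
  simp only [regularTensorEquiv_symm_single]

theorem transport_basisVector {x y z : 𝒢} (f : x ⟶ y) (g : y ⟶ z) :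
    transport (regular x : GroupoidBundle k 𝒢) g (basisVector f) = basisVector (f ≫ g) :=
  Finsupp.mapDomain_single

end Regular

section Braid

variable {V W : GroupoidBundle k 𝒢} (b : HalfBraiding V) {c : HalfBraiding W}

/-- A half-braiding, on the fibres over `x`. -/
def braid (U : GroupoidBundle k 𝒢) (x : 𝒢) : V.obj x ⊗[k] U.obj x →ₗ[k] U.obj x ⊗[k] V.obj x :=
  ((b.β U).hom.app x).hom.hom

theorem braid_injective (U : GroupoidBundle k 𝒢) (x : 𝒢) : Function.Injective (braid b U x) :=
  (FGModuleCat.isoToLinearEquiv ((b.β U).app x)).injective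

theorem braid_transport (U : GroupoidBundle k 𝒢) {x y : 𝒢} (f : x ⟶ y) (v : V.obj x)
    (u : U.obj x) :
    braid b U y (transport V f v ⊗ₜ transport U f u) =
      TensorProduct.map (transport U f) (transport V f) (braid b U x (v ⊗ₜ u)) :=
  congrArg (fun g => g.hom.hom (v ⊗ₜ[k] u)) ((b.β U).hom.naturality f)

theorem braid_fibreMap {U U' : GroupoidBundle k 𝒢} (φ : U ⟶ U') (x : 𝒢) (v : V.obj x)
    (u : U.obj x) :
    braid b U' x (v ⊗ₜ fibreMap φ x u) = (fibreMap φ x).rTensor _ (braid b U x (v ⊗ₜ u)) :=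
  congrArg (fun g => (g.app x).hom.hom (v ⊗ₜ[k] u)) (b.naturality φ)

theorem braid_tensor (U U' : GroupoidBundle k 𝒢) (x : 𝒢) (v : V.obj x) (u : U.obj x)
    (u' : U'.obj x) :
    TensorProduct.assoc k _ _ _ (braid b (U ⊗ U') x (v ⊗ₜ (u ⊗ₜ[k] u'))) =
      (braid b U' x).lTensor (U.obj x) (TensorProduct.assoc k _ _ _
        (braid b U x (v ⊗ₜ u) ⊗ₜ u')) := by
  refine (congrArg (TensorProduct.assoc k (U.obj x) (U'.obj x) (V.obj x))
    (congrArg (fun g => (g.app x).hom.hom (v ⊗ₜ[k] (u ⊗ₜ[k] u')))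
      (b.monoidal U U'))).trans ?_
  exact (TensorProduct.assoc k (U.obj x) (U'.obj x) (V.obj x)).apply_symm_apply _

variable {b} in
theorem braid_whisker_fibreMap {φ : V ⟶ W} (hφ : ∀ U, φ ▷ U ≫ (c.β U).hom = (b.β U).hom ≫ U ◁ φ)
    (U : GroupoidBundle k 𝒢) (x : 𝒢) (v : V.obj x) (u : U.obj x) :
    braid c U x (fibreMap φ x v ⊗ₜ u) = (fibreMap φ x).lTensor _ (braid b U x (v ⊗ₜ u)) :=
  congrArg (fun g => (g.app x).hom.hom (v ⊗ₜ[k] u)) (hφ U)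

variable [∀ x y : 𝒢, Finite (x ⟶ y)]

/-- The components of a vector in a fibre of a central bundle, indexed by the loops at the base
point: they are the coordinates of its half-braiding with the identity in the regular bundle. -/
def components (x : 𝒢) : V.obj x →ₗ[k] (x ⟶ x) →₀ V.obj x :=
  (regularTensorEquiv x x (V.obj x)).toLinearMap ∘ₗ
    braid b (regular x) x ∘ₗ (TensorProduct.mk k _ _).flip (basisVector (𝟙 x))

theorem components_apply (x : 𝒢) (v : V.obj x) :
    components b x v =
      regularTensorEquiv x x (V.obj x) (braid b (regular x) x (v ⊗ₜ basisVector (𝟙 x))) := rfl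

theorem braid_tmul (U : GroupoidBundle k 𝒢) (x : 𝒢) (v : V.obj x) (u : U.obj x) :
    braid b U x (v ⊗ₜ u) = (components b x v).sum fun γ w => transport U γ u ⊗ₜ w := by
  have regular_case : braid b (regular x) x (v ⊗ₜ basisVector (𝟙 x)) =
      (components b x v).sum fun γ w => basisVector γ ⊗ₜ w := by
    rw [← regularTensorEquiv_symm_apply, LinearEquiv.eq_symm_apply, components_apply]
  have lift_case := braid_fibreMap b (regularLift u) x v (basisVector (𝟙 x))
  rw [fibreMap_regularLift, transport_id, regular_case, map_finsuppSum] at lift_case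
  simpa only [LinearMap.rTensor_tmul, fibreMap_regularLift] using lift_case

theorem components_injective (x : 𝒢) : Function.Injective (components b x) := fun v v' h => by
  have hb : braid b (𝟙_ _) x (v ⊗ₜ (1 : k)) = braid b (𝟙_ _) x (v' ⊗ₜ (1 : k)) :=
    (braid_tmul b _ x v _).trans (h ▸ (braid_tmul b _ x v' _).symm)
  simpa only [TensorProduct.rid_tmul, one_smul] using
    congrArg (TensorProduct.rid k (V.obj x)) (braid_injective b _ x hb)

theorem components_hexagon (U U' : GroupoidBundle k 𝒢) (x : 𝒢) (v : V.obj x) (u : U.obj x)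
    (u' : U'.obj x) :
    ((components b x v).sum fun γ w => transport U γ u ⊗ₜ[k] (transport U' γ u' ⊗ₜ[k] w)) =
      (components b x v).sum fun γ w => transport U γ u ⊗ₜ[k] braid b U' x (w ⊗ₜ u') := by
  have hexagon := braid_tensor b U U' x v u u'
  rw [braid_tmul b U, Finsupp.sum, TensorProduct.sum_tmul, map_sum, map_sum] at hexagon
  refine Eq.trans ?_ hexagon
  refine Eq.trans ?_ (congrArg _ (braid_tmul b (U ⊗ U') x v (u ⊗ₜ[k] u'))).symm
  exact (map_sum (TensorProduct.assoc k (U.obj x) (U'.obj x) (V.obj x))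
    (fun γ => (transport U γ u ⊗ₜ transport U' γ u') ⊗ₜ components b x v γ) _).symm

theorem components_components (x : 𝒢) (v : V.obj x) (γ : x ⟶ x) :
    components b x (components b x v γ) = Finsupp.single γ (components b x v γ) := by
  have hexagon := components_hexagon b (regular x) (regular x) x v (basisVector (𝟙 x))
    (basisVector (𝟙 x))
  simp only [transport_basisVector, Category.id_comp] at hexagon
  replace hexagon := DFunLike.congr_fun (congrArg (regularTensorEquiv x x _) hexagon) γ
  simp only [map_finsuppSum, regularTensorEquiv_basisVector] at hexagon
  have hcoeff : basisVector γ ⊗ₜ components b x v γ =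
      braid b (regular x) x (components b x v γ ⊗ₜ basisVector (𝟙 x)) :=
    (sum_single_apply_of_injective Function.injective_id
      (fun _ => TensorProduct.tmul_zero _ _) _ γ).symm.trans <| hexagon.trans <|
      sum_single_apply_of_injective Function.injective_id
        (F := fun _ w => braid b (regular x) x (w ⊗ₜ basisVector (𝟙 x)))
        (fun _ => by rw [TensorProduct.zero_tmul, map_zero]) _ γ
  rw [components_apply, ← hcoeff, regularTensorEquiv_basisVector]

theorem components_sum (x : 𝒢) (v : V.obj x) : ((components b x v).sum fun _ w => w) = v :=
  components_injective b x <| by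
    rw [map_finsuppSum]
    simp only [Finsupp.sum, components_components]
    exact Finsupp.sum_single _

theorem components_transport {x y : 𝒢} (f : x ⟶ y) {γ : x ⟶ x} {γ' : y ⟶ y} (h : γ ≫ f = f ≫ γ')
    (v : V.obj x) : components b y (transport V f v) γ' = transport V f (components b x v γ) := by
  have naturality := braid_transport b (regular x) f v (basisVector (𝟙 x))
  simp only [braid_tmul, map_finsuppSum, TensorProduct.map_tmul, transport_basisVector,
    Category.id_comp] at naturality
  replace naturality :=
    DFunLike.congr_fun (congrArg (regularTensorEquiv x y _) naturality) (f ≫ γ')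
  simp only [map_finsuppSum, regularTensorEquiv_basisVector] at naturality
  rwa [sum_single_apply_of_injective (fun _ _ => (cancel_epi f).1) (fun _ => rfl), ← h,
    sum_single_apply_of_injective (fun _ _ => (cancel_mono f).1) (fun _ => map_zero _)]
    at naturality

theorem components_fibreMap {φ : V ⟶ W} (hφ : ∀ U, φ ▷ U ≫ (c.β U).hom = (b.β U).hom ≫ U ◁ φ)
    (x : 𝒢) (v : V.obj x) (γ : x ⟶ x) :
    components c x (fibreMap φ x v) γ = fibreMap φ x (components b x v γ) := by
  have centrality := braid_whisker_fibreMap hφ (regular x) x v (basisVector (𝟙 x))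
  rw [braid_tmul b, map_finsuppSum] at centrality
  simp only [LinearMap.lTensor_tmul, transport_basisVector, Category.id_comp] at centrality
  rw [components_apply, centrality, map_finsuppSum]
  simp only [regularTensorEquiv_basisVector]
  exact sum_single_apply_of_injective Function.injective_id (fun _ => map_zero _) _ γ

end Braid

end GroupoidBundle

/-! ### Bundles over the inertia groupoid -/

/-- The inertia groupoid: its objects are the loops of a groupoid, its morphisms the
morphisms between base points that conjugate one loop into the other. -/
structure LoopGroupoid (𝒢 : Type u) [Groupoid.{u} 𝒢] where
  base : 𝒢
  loop : base ⟶ base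

namespace LoopGroupoid

variable {𝒢 : Type u} [Groupoid.{u} 𝒢]

instance instGroupoid : Groupoid.{u} (LoopGroupoid 𝒢) where
  Hom ω ω' := {f : ω.base ⟶ ω'.base // ω.loop ≫ f = f ≫ ω'.loop}
  id ω := ⟨𝟙 ω.base, by rw [Category.id_comp, Category.comp_id]⟩
  comp f g := ⟨f.1 ≫ g.1, by rw [← Category.assoc, f.2, Category.assoc, g.2, Category.assoc]⟩
  id_comp f := Subtype.ext (Category.id_comp f.1)
  comp_id f := Subtype.ext (Category.comp_id f.1)
  assoc f g h := Subtype.ext (Category.assoc f.1 g.1 h.1)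
  inv f := ⟨Groupoid.inv f.1, by
    rw [← cancel_epi f.1, ← Category.assoc, ← f.2, Category.assoc, Groupoid.comp_inv,
      Category.comp_id, ← Category.assoc, Groupoid.comp_inv, Category.id_comp]⟩
  inv_comp f := Subtype.ext (Groupoid.inv_comp f.1)
  comp_inv f := Subtype.ext (Groupoid.comp_inv f.1)

/-- A morphism out of the base point of a loop, as a morphism to the conjugate loop. -/
def conjHom {x y : 𝒢} (f : x ⟶ y) (γ : x ⟶ x) :
    (⟨x, γ⟩ : LoopGroupoid 𝒢) ⟶ ⟨y, Groupoid.inv f ≫ γ ≫ f⟩ :=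
  ⟨f, by rw [← Category.assoc f, Groupoid.comp_inv, Category.id_comp]⟩

end LoopGroupoid

namespace GroupoidBundle

open LoopGroupoid

variable {k 𝒢 : Type u} [CommRing k] [Groupoid.{u} 𝒢]

section Total

variable (W : GroupoidBundle k (LoopGroupoid 𝒢))

/-- The direct sum of the fibres of a bundle over the loops based at `x`. -/
abbrev TotalFibre (x : 𝒢) : Type u := ⨁ γ : x ⟶ x, W.obj ⟨x, γ⟩

open scoped Classical in
/-- The inclusion of the summand of a loop. -/
def inclusion (ω : LoopGroupoid 𝒢) : W.obj ω →ₗ[k] TotalFibre W ω.base :=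
  lof k (ω.base ⟶ ω.base) (fun γ => W.obj ⟨ω.base, γ⟩) ω.loop

variable {W} in
theorem totalFibre_hom_ext {x : 𝒢} {M : Type*} [AddCommGroup M] [Module k M]
    {φ ψ : TotalFibre W x →ₗ[k] M}
    (h : ∀ (γ : x ⟶ x) (w : W.obj ⟨x, γ⟩), φ (inclusion W ⟨x, γ⟩ w) = ψ (inclusion W ⟨x, γ⟩ w)) :
    φ = ψ := by
  classical exact DirectSum.linearMap_ext k fun γ => LinearMap.ext (h γ)

variable {W} in
theorem totalFibre_tensor_hom_ext {x : 𝒢} {M N : Type*} [AddCommGroup M] [Module k M]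
    [AddCommGroup N] [Module k N] {φ ψ : TotalFibre W x ⊗[k] N →ₗ[k] M}
    (h : ∀ (γ : x ⟶ x) (w : W.obj ⟨x, γ⟩) (n : N),
      φ (inclusion W ⟨x, γ⟩ w ⊗ₜ n) = ψ (inclusion W ⟨x, γ⟩ w ⊗ₜ n)) : φ = ψ :=
  TensorProduct.ext <| totalFibre_hom_ext fun γ w => LinearMap.ext (h γ w)

variable {W} in
theorem totalFibre_tensor_tensor_hom_ext {x : 𝒢} {M N N' : Type*} [AddCommGroup M] [Module k M]
    [AddCommGroup N] [Module k N] [AddCommGroup N'] [Module k N']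
    {φ ψ : TotalFibre W x ⊗[k] (N ⊗[k] N') →ₗ[k] M}
    (h : ∀ (γ : x ⟶ x) (w : W.obj ⟨x, γ⟩) (n : N) (n' : N'),
      φ (inclusion W ⟨x, γ⟩ w ⊗ₜ (n ⊗ₜ n')) = ψ (inclusion W ⟨x, γ⟩ w ⊗ₜ (n ⊗ₜ n'))) : φ = ψ :=
  TensorProduct.ext <| totalFibre_hom_ext fun γ w => TensorProduct.ext' (h γ w)

open scoped Classical in
/-- The action of a morphism on the total fibres permutes the summands by conjugation. -/
def totalTransport {x y : 𝒢} (f : x ⟶ y) : TotalFibre W x →ₗ[k] TotalFibre W y :=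
  toModule k _ _ fun γ => inclusion W ⟨y, _⟩ ∘ₗ transport W (conjHom f γ)

theorem totalTransport_inclusion {ω ω' : LoopGroupoid 𝒢} (a : ω ⟶ ω') (w : W.obj ω) :
    totalTransport W a.1 (inclusion W ω w) = inclusion W ω' (transport W a w) := by
  classical
  obtain ⟨x, γ⟩ := ω
  obtain ⟨y, γ'⟩ := ω'
  obtain ⟨f : x ⟶ y, hf : γ ≫ f = f ≫ γ'⟩ := a
  obtain rfl : Groupoid.inv f ≫ γ ≫ f = γ' := by
    rw [hf, ← Category.assoc, Groupoid.inv_comp, Category.id_comp]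
  exact toModule_lof k _ _

open scoped Classical in
/-- The exchange of a total fibre with the fibre of a bundle on which the loops act. -/
def totalBraid (U : GroupoidBundle k 𝒢) (x : 𝒢) :
    TotalFibre W x ⊗[k] U.obj x ≃ₗ[k] U.obj x ⊗[k] TotalFibre W x :=
  twistedComm fun γ => FGModuleCat.isoToLinearEquiv (U.mapIso (asIso γ))

theorem totalBraid_inclusion_tmul (U : GroupoidBundle k 𝒢) {x : 𝒢} (γ : x ⟶ x)
    (w : W.obj ⟨x, γ⟩) (u : U.obj x) :
    totalBraid W U x (inclusion W ⟨x, γ⟩ w ⊗ₜ u) = transport U γ u ⊗ₜ inclusion W ⟨x, γ⟩ w := by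
  classical exact twistedComm_lof_tmul _ _ _ _

variable [∀ x y : 𝒢, Finite (x ⟶ y)]

/-- The push-forward of a bundle over loops to the base points. -/
def total : GroupoidBundle k 𝒢 where
  obj x := FGModuleCat.of k (TotalFibre W x)
  map f := FGModuleCat.ofHom (totalTransport W f)
  map_id x := FGModuleCat.hom_ext <| totalFibre_hom_ext fun γ w =>
    (totalTransport_inclusion W (𝟙 ⟨x, γ⟩) w).trans (congrArg _ (transport_id W _ w))
  map_comp f g := FGModuleCat.hom_ext <| totalFibre_hom_ext fun γ w => by
    refine (totalTransport_inclusion W (conjHom f γ ≫ conjHom g _) w).trans ?_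
    rw [transport_comp, ← totalTransport_inclusion W (conjHom g _),
      ← totalTransport_inclusion W (conjHom f γ)]
    rfl

theorem transport_total_inclusion {ω ω' : LoopGroupoid 𝒢} (a : ω ⟶ ω') (w : W.obj ω) :
    transport (total W) a.1 (inclusion W ω w) = inclusion W ω' (transport W a w) :=
  totalTransport_inclusion W a w

/-- The half-braiding of the push-forward, moving the loops across the tensor product. -/
def totalHalfBraiding : HalfBraiding (total W) where
  β U := NatIso.ofComponents (fun x => (totalBraid W U x).toFGModuleCatIso) fun {x y} f =>
    FGModuleCat.hom_ext <| totalFibre_tensor_hom_ext fun γ w u => by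
      have conjugate := transport_total_inclusion W (conjHom f γ) w
      refine (congrArg (fun t => totalBraid W U y (t ⊗ₜ transport U f u)) conjugate).trans ?_
      refine (totalBraid_inclusion_tmul W U _ _ _).trans ?_
      refine Eq.trans ?_ (congrArg (transport (U ⊗ total W) f)
        (totalBraid_inclusion_tmul W U γ w u)).symm
      refine Eq.trans ?_ (transport_tmul U (total W) f _ _).symm
      rw [← transport_comp, ← transport_comp]
      exact congrArg₂ (transport U · u ⊗ₜ[k] ·) (conjHom f γ).2.symm conjugate.symm
  monoidal U U' := NatTrans.ext <| funext fun x => FGModuleCat.hom_ext <|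
    totalFibre_tensor_tensor_hom_ext fun γ w u u' => by
      refine (totalBraid_inclusion_tmul W (U ⊗ U') γ w (u ⊗ₜ[k] u')).trans ?_
      have hexagon : (totalBraid W U' x).toLinearMap.lTensor (U.obj x)
          (TensorProduct.assoc k _ _ _ (totalBraid W U x (inclusion W ⟨x, γ⟩ w ⊗ₜ u) ⊗ₜ u')) =
          transport U γ u ⊗ₜ (transport U' γ u' ⊗ₜ inclusion W ⟨x, γ⟩ w) := by
        rw [totalBraid_inclusion_tmul, TensorProduct.assoc_tmul, LinearMap.lTensor_tmul]
        exact congrArg _ (totalBraid_inclusion_tmul W U' γ w u')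
      exact (congrArg (TensorProduct.assoc k _ _ _).symm hexagon).symm
  naturality {U U'} φ := NatTrans.ext <| funext fun x => FGModuleCat.hom_ext <|
    totalFibre_tensor_hom_ext fun γ w u => by
      refine (totalBraid_inclusion_tmul W U' γ w (fibreMap φ x u)).trans ?_
      refine Eq.trans ?_ (congrArg ((fibreMap φ x).rTensor _)
        (totalBraid_inclusion_tmul W U γ w u)).symm
      rw [LinearMap.rTensor_tmul, fibreMap_transport]

end Total

section TotalMap

variable {W W' : GroupoidBundle k (LoopGroupoid 𝒢)}

theorem inclusion_injective (ω : LoopGroupoid 𝒢) : Function.Injective (inclusion W ω) := by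
  classical exact DirectSum.of_injective _

theorem inclusion_apply_self {x : 𝒢} (γ : x ⟶ x) (w : W.obj ⟨x, γ⟩) :
    (inclusion W ⟨x, γ⟩ w : TotalFibre W x) γ = w := by
  classical exact DirectSum.of_eq_same (β := fun γ => W.obj ⟨x, γ⟩) γ w

theorem inclusion_apply_of_ne {x : 𝒢} {γ γ' : x ⟶ x} (h : γ ≠ γ') (w : W.obj ⟨x, γ⟩) :
    (inclusion W ⟨x, γ⟩ w : TotalFibre W x) γ' = 0 := by
  classical exact DirectSum.of_eq_of_ne (β := fun γ => W.obj ⟨x, γ⟩) γ γ' w h.symm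

/-- The map on total fibres induced by a morphism of bundles over loops. -/
def totalFibreMap (φ : W ⟶ W') (x : 𝒢) : TotalFibre W x →ₗ[k] TotalFibre W' x :=
  lmap fun γ => fibreMap φ ⟨x, γ⟩

theorem totalFibreMap_inclusion (φ : W ⟶ W') (ω : LoopGroupoid 𝒢) (w : W.obj ω) :
    totalFibreMap φ ω.base (inclusion W ω w) = inclusion W' ω (fibreMap φ ω w) := by
  classical exact lmap_lof _ _ _

variable [∀ x y : 𝒢, Finite (x ⟶ y)]

theorem braid_totalHalfBraiding (U : GroupoidBundle k 𝒢) {x : 𝒢} (γ : x ⟶ x) (w : W.obj ⟨x, γ⟩)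
    (u : U.obj x) :
    braid (totalHalfBraiding W) U x (inclusion W ⟨x, γ⟩ w ⊗ₜ u) =
      transport U γ u ⊗ₜ inclusion W ⟨x, γ⟩ w :=
  totalBraid_inclusion_tmul W U γ w u

theorem components_inclusion {x : 𝒢} (γ : x ⟶ x) (w : W.obj ⟨x, γ⟩) :
    components (totalHalfBraiding W) x (inclusion W ⟨x, γ⟩ w) =
      Finsupp.single γ (inclusion W ⟨x, γ⟩ w) := by
  refine (congrArg (regularTensorEquiv x x (TotalFibre W x))
    (braid_totalHalfBraiding (regular x) γ w (basisVector (𝟙 x)))).trans ?_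
  rw [transport_basisVector, Category.id_comp]
  exact regularTensorEquiv_basisVector γ _

theorem components_totalHalfBraiding {x : 𝒢} (γ : x ⟶ x) (t : TotalFibre W x) :
    components (totalHalfBraiding W) x t γ = inclusion W ⟨x, γ⟩ (t γ) := by
  classical
  refine LinearMap.congr_fun (f := Finsupp.lapply γ ∘ₗ components (totalHalfBraiding W) x)
    (g := inclusion W ⟨x, γ⟩ ∘ₗ component k _ _ γ)
    (totalFibre_hom_ext fun γ' w => ?_) t
  refine (DFunLike.congr_fun (components_inclusion γ' w) γ).trans ?_
  obtain rfl | h := eq_or_ne γ' γ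
  · exact Finsupp.single_eq_same.trans (congrArg _ (inclusion_apply_self γ' w).symm)
  · exact (Finsupp.single_eq_of_ne h.symm).trans <| (map_zero _).symm.trans <|
      congrArg (inclusion W _) (inclusion_apply_of_ne h w).symm

/-- The morphism of push-forwards induced by a morphism of bundles over loops. -/
def totalMap (φ : W ⟶ W') : total W ⟶ total W' where
  app x := FGModuleCat.ofHom (totalFibreMap φ x)
  naturality x y f := FGModuleCat.hom_ext <| totalFibre_hom_ext fun γ w => by
    refine (congrArg (totalFibreMap φ y) (totalTransport_inclusion W (conjHom f γ) w)).trans ?_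
    refine (totalFibreMap_inclusion φ ⟨y, _⟩ _).trans ?_
    refine Eq.trans ?_ (congrArg (totalTransport W' f) (totalFibreMap_inclusion φ ⟨x, γ⟩ w)).symm
    refine Eq.trans ?_ (totalTransport_inclusion W' (conjHom f γ) _).symm
    rw [fibreMap_transport]

theorem totalMap_braid (φ : W ⟶ W') (U : GroupoidBundle k 𝒢) :
    totalMap φ ▷ U ≫ ((totalHalfBraiding W').β U).hom =
      ((totalHalfBraiding W).β U).hom ≫ U ◁ totalMap φ :=
  NatTrans.ext <| funext fun x => FGModuleCat.hom_ext <| totalFibre_tensor_hom_ext fun γ w u => by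
    refine (congrArg (fun t => totalBraid W' U x (t ⊗ₜ[k] u))
      (totalFibreMap_inclusion φ ⟨x, γ⟩ w)).trans ?_
    refine (totalBraid_inclusion_tmul W' U γ _ u).trans ?_
    refine Eq.trans ?_ (congrArg ((totalFibreMap φ x).lTensor (U.obj x))
      (totalBraid_inclusion_tmul W U γ w u)).symm
    exact congrArg (TensorProduct.mk k _ _ _) (totalFibreMap_inclusion φ ⟨x, γ⟩ w).symm

end TotalMap

variable [∀ x y : 𝒢, Finite (x ⟶ y)]

variable (k 𝒢) in
/-- Bundles over loops as central bundles over base points. -/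
def loopTotal : GroupoidBundle k (LoopGroupoid 𝒢) ⥤ Center (GroupoidBundle k 𝒢) where
  obj W := ⟨total W, totalHalfBraiding W⟩
  map φ := ⟨totalMap φ, totalMap_braid φ⟩
  map_id W := Center.ext _ _ <| hom_ext fun x => LinearMap.congr_fun <|
    totalFibre_hom_ext fun γ w => totalFibreMap_inclusion (𝟙 W) ⟨x, γ⟩ w
  map_comp φ ψ := Center.ext _ _ <| hom_ext fun x => LinearMap.congr_fun <|
    totalFibre_hom_ext fun γ w => by
      refine (totalFibreMap_inclusion (φ ≫ ψ) ⟨x, γ⟩ w).trans ?_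
      refine Eq.trans ?_ (congrArg (totalFibreMap ψ x)
        (totalFibreMap_inclusion φ ⟨x, γ⟩ w)).symm
      exact (totalFibreMap_inclusion ψ ⟨x, γ⟩ _).symm

instance additive_loopTotal : (loopTotal k 𝒢).Additive where
  map_add {W W' φ ψ} := Center.ext _ _ <| hom_ext fun x => LinearMap.congr_fun <|
    totalFibre_hom_ext fun γ w => by
      refine (totalFibreMap_inclusion (φ + ψ) ⟨x, γ⟩ w).trans ?_
      refine ((inclusion W' ⟨x, γ⟩).map_add _ _).trans ?_
      exact congrArg₂ (· + ·) (totalFibreMap_inclusion φ ⟨x, γ⟩ w).symm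
        (totalFibreMap_inclusion ψ ⟨x, γ⟩ w).symm

instance linear_loopTotal : (loopTotal k 𝒢).Linear k where
  map_smul {W W'} φ r := Center.ext _ _ <| hom_ext fun x => LinearMap.congr_fun <|
    totalFibre_hom_ext fun γ w => by
      refine (totalFibreMap_inclusion (r • φ) ⟨x, γ⟩ w).trans ?_
      refine ((inclusion W' ⟨x, γ⟩).map_smul r _).trans ?_
      exact congrArg (r • ·) (totalFibreMap_inclusion φ ⟨x, γ⟩ w).symm

instance faithful_loopTotal : (loopTotal k 𝒢).Faithful where
  map_injective {W W' φ ψ} h := hom_ext fun ω w => inclusion_injective ω <| by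
    rw [← totalFibreMap_inclusion, ← totalFibreMap_inclusion]
    exact congrArg (fun F : Center.Hom _ _ => fibreMap F.f ω.base (inclusion W ω w)) h

section Full

variable {W W' : GroupoidBundle k (LoopGroupoid 𝒢)}
  (F : (loopTotal k 𝒢).obj W ⟶ (loopTotal k 𝒢).obj W')

/-- The restriction of a central morphism of push-forwards to the fibre of a loop. -/
def loopComponent (ω : LoopGroupoid 𝒢) : W.obj ω →ₗ[k] W'.obj ω :=
  component k _ (fun γ => W'.obj ⟨ω.base, γ⟩) ω.loop ∘ₗ fibreMap F.f ω.base ∘ₗ inclusion W ω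

theorem inclusion_loopComponent (ω : LoopGroupoid 𝒢) (w : W.obj ω) :
    inclusion W' ω (loopComponent F ω w) = fibreMap F.f ω.base (inclusion W ω w) := by
  refine (components_totalHalfBraiding ω.loop _).symm.trans ?_
  refine (components_fibreMap (totalHalfBraiding W) F.comm ω.base _ ω.loop).trans ?_
  refine congrArg (fibreMap F.f ω.base) ?_
  exact (DFunLike.congr_fun (components_inclusion ω.loop w) ω.loop).trans Finsupp.single_eq_same

instance full_loopTotal : (loopTotal k 𝒢).Full where
  map_surjective {W W'} F := by
    refine ⟨⟨fun ω => FGModuleCat.ofHom (loopComponent F ω), fun ω ω' a =>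
      FGModuleCat.hom_ext <| LinearMap.ext fun w => inclusion_injective ω' ?_⟩,
      Center.ext _ _ <| hom_ext fun x => LinearMap.congr_fun <| totalFibre_hom_ext fun γ w => ?_⟩
    · refine (inclusion_loopComponent F ω' _).trans ?_
      refine (congrArg (fibreMap F.f ω'.base) (transport_total_inclusion W a w).symm).trans ?_
      refine (fibreMap_transport F.f a.1 _).trans ?_
      refine (congrArg (transport (total W') a.1) (inclusion_loopComponent F ω w).symm).trans ?_
      exact transport_total_inclusion W' a _
    · exact (totalFibreMap_inclusion _ ⟨x, γ⟩ w).trans (inclusion_loopComponent F ⟨x, γ⟩ w)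

end Full

section EssSurj

variable {V : GroupoidBundle k 𝒢} (b : HalfBraiding V)

/-- The vectors in the fibre of a central bundle with no component outside a given loop. -/
def homogeneousPart (ω : LoopGroupoid 𝒢) : Submodule k (V.obj ω.base) :=
  LinearMap.range (Finsupp.lapply ω.loop ∘ₗ components b ω.base)

instance finite_homogeneousPart (ω : LoopGroupoid 𝒢) : Module.Finite k (homogeneousPart b ω) :=
  inferInstanceAs <| Module.Finite k
    (LinearMap.range (Finsupp.lapply ω.loop ∘ₗ components b ω.base))

variable {b} in
theorem components_of_mem {ω : LoopGroupoid 𝒢} {v : V.obj ω.base} (hv : v ∈ homogeneousPart b ω) :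
    components b ω.base v = Finsupp.single ω.loop v := by
  obtain ⟨v, rfl⟩ := hv
  exact components_components b ω.base v ω.loop

variable {b} in
theorem transport_mem {ω ω' : LoopGroupoid 𝒢} (a : ω ⟶ ω') :
    ∀ v ∈ homogeneousPart b ω, transport V a.1 v ∈ homogeneousPart b ω' := by
  rintro _ ⟨v, rfl⟩
  exact ⟨transport V a.1 v, components_transport b a.1 a.2 v⟩

/-- The bundle over loops of the homogeneous vectors of a central bundle. -/
def homogeneousBundle : GroupoidBundle k (LoopGroupoid 𝒢) where
  obj ω := FGModuleCat.of k (homogeneousPart b ω)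
  map a := FGModuleCat.ofHom ((transport V a.1).restrict (transport_mem a))
  map_id ω := FGModuleCat.hom_ext <| LinearMap.ext fun v => Subtype.ext (transport_id V ω.base v.1)
  map_comp f g := FGModuleCat.hom_ext <| LinearMap.ext fun v =>
    Subtype.ext (transport_comp V f.1 g.1 v.1)

open scoped Classical in
/-- The sum map from the homogeneous parts to the fibre of a central bundle. -/
def homogeneousSum (x : 𝒢) : TotalFibre (homogeneousBundle b) x →ₗ[k] V.obj x :=
  toModule k _ _ fun γ => (homogeneousPart b ⟨x, γ⟩).subtype

theorem homogeneousSum_inclusion (ω : LoopGroupoid 𝒢) (v : homogeneousPart b ω) :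
    homogeneousSum b ω.base (inclusion (homogeneousBundle b) ω v) = v := by
  classical exact toModule_lof k _ _

/-- The sum of homogeneous vectors, as a morphism of bundles. -/
def homogeneousSumHom : total (homogeneousBundle b) ⟶ V where
  app x := FGModuleCat.ofHom (homogeneousSum b x)
  naturality x y f := FGModuleCat.hom_ext <| totalFibre_hom_ext fun γ v => by
    refine (congrArg (homogeneousSum b y)
      (totalTransport_inclusion (homogeneousBundle b) (conjHom f γ) v)).trans ?_
    refine (homogeneousSum_inclusion b ⟨y, _⟩ _).trans ?_
    exact (congrArg (transport V f) (homogeneousSum_inclusion b ⟨x, γ⟩ v)).symm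

theorem homogeneousSumHom_braid (U : GroupoidBundle k 𝒢) :
    homogeneousSumHom b ▷ U ≫ (b.β U).hom =
      ((totalHalfBraiding (homogeneousBundle b)).β U).hom ≫ U ◁ homogeneousSumHom b :=
  NatTrans.ext <| funext fun x => FGModuleCat.hom_ext <|
    totalFibre_tensor_hom_ext fun γ (v : homogeneousPart b ⟨x, γ⟩) u => by
    refine (congrArg (fun t => braid b U x (t ⊗ₜ[k] u))
      (homogeneousSum_inclusion b ⟨x, γ⟩ v)).trans ?_
    refine Eq.trans ?_ (congrArg ((homogeneousSum b x).lTensor (U.obj x))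
      (totalBraid_inclusion_tmul (homogeneousBundle b) U γ v u)).symm
    refine Eq.trans ?_ (congrArg (TensorProduct.mk k _ _ (transport U γ u))
      (homogeneousSum_inclusion b ⟨x, γ⟩ v).symm)
    rw [braid_tmul]
    refine (congrArg (Finsupp.sum · _) (components_of_mem v.2)).trans ?_
    exact Finsupp.sum_single_index (TensorProduct.tmul_zero _ _)

theorem components_homogeneousSum {x : 𝒢} (t : TotalFibre (homogeneousBundle b) x) (γ : x ⟶ x) :
    components b x (homogeneousSum b x t) γ = homogeneousSum b x (inclusion _ ⟨x, γ⟩ (t γ)) :=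
  (components_fibreMap _ (homogeneousSumHom_braid b) x t γ).trans <|
    congrArg (homogeneousSum b x) (components_totalHalfBraiding γ t)

theorem homogeneousSum_bijective (x : 𝒢) : Function.Bijective (homogeneousSum b x) := by
  constructor
  · refine fun t t' h => DFinsupp.ext fun γ => Subtype.ext ?_
    have hγ := DFunLike.congr_fun (congrArg (components b x) h) γ
    rw [components_homogeneousSum, components_homogeneousSum] at hγ
    exact (homogeneousSum_inclusion b ⟨x, γ⟩ _).symm.trans
      (hγ.trans (homogeneousSum_inclusion b ⟨x, γ⟩ _))
  · intro v
    refine ⟨∑ γ ∈ (components b x v).support,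
      inclusion (homogeneousBundle b) ⟨x, γ⟩ ⟨components b x v γ, v, rfl⟩, ?_⟩
    rw [map_sum]
    refine Eq.trans ?_ (components_sum b x v)
    exact Finset.sum_congr rfl fun γ _ => homogeneousSum_inclusion b ⟨x, γ⟩ _

instance isIso_homogeneousSumHom : IsIso (homogeneousSumHom b) := by
  have (x : 𝒢) : IsIso ((homogeneousSumHom b).app x) := inferInstanceAs <| IsIso
    (LinearEquiv.ofBijective _ (homogeneousSum_bijective b x)).toFGModuleCatIso.hom
  exact NatIso.isIso_of_isIso_app _

instance essSurj_loopTotal : (loopTotal k 𝒢).EssSurj where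
  mem_essImage A :=
    let F : (loopTotal k 𝒢).obj (homogeneousBundle A.2) ⟶ A :=
      ⟨homogeneousSumHom A.2, homogeneousSumHom_braid A.2⟩
    have : IsIso F.f := isIso_homogeneousSumHom A.2
    ⟨homogeneousBundle A.2, ⟨Center.isoMk F⟩⟩

instance isEquivalence_loopTotal : (loopTotal k 𝒢).IsEquivalence where

end EssSurj

end GroupoidBundle

theorem isAbelianCategory_of_isEquivalence {C D : Type*} [Category* C] [Category* D]
    [Preadditive C] [Abelian D] (F : C ⥤ D) [F.IsEquivalence] : IsAbelianCategory C := by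
  have : Limits.HasFiniteProducts C :=
    ⟨fun _ => Adjunction.hasLimitsOfShape_of_equivalence F⟩
  exact ⟨abelianOfEquivalence F, rfl⟩

/-! ### The Drinfeld center under monoidal equivalences -/

section CenterFunctoriality

open Functor.LaxMonoidal Functor.OplaxMonoidal

variable {C D : Type*} [Category* C] [Category* D] [MonoidalCategory C] [MonoidalCategory D]

/-- The half-braiding obtained by conjugation with an isomorphism. -/
def isoHalfBraiding {X Y : D} (c : HalfBraiding Y) (i : X ≅ Y) : HalfBraiding X where
  β U := whiskerRightIso i U ≪≫ c.β U ≪≫ whiskerLeftIso U i.symm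
  monoidal U U' := by simp [c.monoidal]
  naturality f := by
    simp [whisker_exchange_assoc, c.naturality_assoc, whisker_exchange]

variable (F : C ⥤ D) [F.Monoidal] {V : C}

/-- The image of a half-braiding under a monoidal functor, defined on the image of the functor
only. -/
def imageBraiding (b : HalfBraiding V) (U : C) :
    F.obj V ⊗ F.obj U ≅ F.obj U ⊗ F.obj V :=
  Functor.Monoidal.μIso F V U ≪≫ F.mapIso (b.β U) ≪≫ (Functor.Monoidal.μIso F U V).symm

theorem imageBraiding_hom (b : HalfBraiding V) (U : C) :
    (imageBraiding F b U).hom = μ F V U ≫ F.map (b.β U).hom ≫ δ F U V := rfl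

theorem imageBraiding_naturality (b : HalfBraiding V) {U U' : C} (f : U ⟶ U') :
    F.obj V ◁ F.map f ≫ (imageBraiding F b U').hom =
      (imageBraiding F b U).hom ≫ F.map f ▷ F.obj V := by
  simp only [imageBraiding_hom, Category.assoc]
  rw [δ_natural_left, ← F.map_comp_assoc (b.β U).hom, ← b.naturality, F.map_comp_assoc,
    μ_natural_right_assoc]

theorem imageBraiding_tensor (b : HalfBraiding V) (U U' : C) :
    (imageBraiding F b (U ⊗ U')).hom =
      F.obj V ◁ δ F U U' ≫ (α_ _ _ _).inv ≫ (imageBraiding F b U).hom ▷ F.obj U' ≫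
        (α_ _ _ _).hom ≫ F.obj U ◁ (imageBraiding F b U').hom ≫ (α_ _ _ _).inv ≫
          μ F U U' ▷ F.obj V := by
  simp only [imageBraiding_hom, b.monoidal, F.map_comp, Functor.Monoidal.map_whiskerLeft,
    Functor.Monoidal.map_whiskerRight, Functor.Monoidal.map_associator,
    Functor.Monoidal.map_associator_inv, Category.assoc, comp_whiskerRight,
    MonoidalCategory.whiskerLeft_comp, Functor.Monoidal.μ_δ_assoc,
    Functor.Monoidal.μ_δ, Category.comp_id]

section Pull

variable [F.Full] [F.Faithful]

/-- The half-braiding whose image under a fully faithful monoidal functor is given. -/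
def pullHalfBraiding (c : HalfBraiding (F.obj V)) : HalfBraiding V where
  β U := F.preimageIso ((Functor.Monoidal.μIso F V U).symm ≪≫ c.β (F.obj U) ≪≫
    Functor.Monoidal.μIso F U V)
  monoidal U U' := F.map_injective <| by
    have h : (c.β (F.obj (U ⊗ U'))).hom =
        F.obj V ◁ δ F U U' ≫ (c.β (F.obj U ⊗ F.obj U')).hom ≫ μ F U U' ▷ F.obj V := by
      rw [c.naturality_assoc, ← comp_whiskerRight, Functor.Monoidal.δ_μ, id_whiskerRight,
        Category.comp_id]
    simp only [Functor.preimageIso_hom, Functor.map_preimage, Iso.trans_hom, Iso.symm_hom,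
      Functor.Monoidal.μIso_hom, Functor.Monoidal.μIso_inv, F.map_comp, h, c.monoidal,
      Functor.Monoidal.map_whiskerLeft, Functor.Monoidal.map_whiskerRight,
      Functor.Monoidal.map_associator, Functor.Monoidal.map_associator_inv, Category.assoc,
      comp_whiskerRight, MonoidalCategory.whiskerLeft_comp, Functor.Monoidal.μ_δ_assoc,
      Functor.Monoidal.whiskerRight_μ_δ_assoc, Functor.Monoidal.whiskerLeft_μ_δ_assoc]
  naturality {U U'} f := F.map_injective <| by
    simp only [Functor.preimageIso_hom, Functor.map_preimage, Iso.trans_hom, Iso.symm_hom,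
      Functor.Monoidal.μIso_hom, Functor.Monoidal.μIso_inv, F.map_comp, Category.assoc,
      Functor.Monoidal.map_whiskerLeft, Functor.Monoidal.map_whiskerRight,
      Functor.Monoidal.μ_δ_assoc, c.naturality_assoc]

theorem imageBraiding_pullHalfBraiding (c : HalfBraiding (F.obj V)) (U : C) :
    imageBraiding F (pullHalfBraiding F c) U = c.β (F.obj U) := by
  ext
  simp [imageBraiding, pullHalfBraiding]

end Pull

section Push

variable [F.Full] [F.EssSurj]

/-- The isomorphisms underlying `pushHalfBraiding`, extending `imageBraiding` from the image of `F`
by essential surjectivity. -/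
def pushBraiding (b : HalfBraiding V) (W : D) : F.obj V ⊗ W ≅ W ⊗ F.obj V :=
  whiskerLeftIso (F.obj V) (F.objObjPreimageIso W).symm ≪≫ imageBraiding F b (F.objPreimage W) ≪≫
    whiskerRightIso (F.objObjPreimageIso W) (F.obj V)

theorem whiskerLeft_pushBraiding (b : HalfBraiding V) {U : C} {W : D} (j : F.obj U ⟶ W) :
    F.obj V ◁ j ≫ (pushBraiding F b W).hom = (imageBraiding F b U).hom ≫ j ▷ F.obj V := by
  obtain ⟨g, hg⟩ := F.map_surjective (j ≫ (F.objObjPreimageIso W).inv)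
  obtain rfl : F.map g ≫ (F.objObjPreimageIso W).hom = j := by simp [hg]
  simp [pushBraiding, reassoc_of% imageBraiding_naturality F b g]

/-- The image of a half-braiding under a monoidal equivalence. -/
def pushHalfBraiding (b : HalfBraiding V) : HalfBraiding (F.obj V) where
  β := pushBraiding F b
  monoidal W W' := by
    set i := F.objObjPreimageIso W
    set i' := F.objObjPreimageIso W'
    let j := δ F (F.objPreimage W) (F.objPreimage W') ≫ (i.hom ⊗ₘ i'.hom)
    have himage : F.obj V ◁ j ≫ (pushBraiding F b (W ⊗ W')).hom = F.obj V ◁ δ F _ _ ≫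
        (α_ _ _ _).inv ≫ (imageBraiding F b _).hom ▷ _ ≫ (α_ _ _ _).hom ≫ i.hom ▷ _ ≫
          W ◁ ((imageBraiding F b _).hom ≫ i'.hom ▷ _) ≫ (α_ _ _ _).inv := by
      rw [whiskerLeft_pushBraiding, imageBraiding_tensor, MonoidalCategory.whiskerLeft_comp_assoc,
        ← whisker_exchange_assoc]
      simp [j, MonoidalCategory.tensorHom_def]
    have hslide : F.obj V ◁ j ≫ (α_ _ _ _).inv ≫ (pushBraiding F b W).hom ▷ W' ≫
        (α_ _ _ _).hom = F.obj V ◁ δ F _ _ ≫ (α_ _ _ _).inv ≫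
          (F.obj V ◁ i.hom ≫ (pushBraiding F b W).hom) ▷ _ ≫ (α_ _ _ _).hom ≫
            W ◁ F.obj V ◁ i'.hom := by
      rw [← associator_naturality_right, ← whisker_exchange_assoc]
      simp [j, tensorHom_def']
    rw [← cancel_epi (F.obj V ◁ j), himage, reassoc_of% hslide, whiskerLeft_pushBraiding,
      ← MonoidalCategory.whiskerLeft_comp_assoc, whiskerLeft_pushBraiding]
    simp
  naturality {W W'} f := by
    rw [← cancel_epi (F.obj V ◁ (F.objObjPreimageIso W).hom),
      reassoc_of% whiskerLeft_pushBraiding F _, ← comp_whiskerRight, ← whiskerLeft_pushBraiding,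
      MonoidalCategory.whiskerLeft_comp_assoc]

end Push

theorem map_comm_imageBraiding_iff [F.Faithful] {V' : C} (b : HalfBraiding V)
    (b' : HalfBraiding V') (f : V ⟶ V') (U : C) :
    F.map f ▷ F.obj U ≫ (imageBraiding F b' U).hom =
        (imageBraiding F b U).hom ≫ F.obj U ◁ F.map f ↔
      f ▷ U ≫ (b'.β U).hom = (b.β U).hom ≫ U ◁ f := by
  rw [imageBraiding_hom, imageBraiding_hom, μ_natural_left_assoc, Category.assoc, Category.assoc,
    δ_natural_right, ← F.map_comp_assoc, ← F.map_comp_assoc, cancel_epi, cancel_mono,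
    F.map_injective.eq_iff]

section MapCenter

variable [F.IsEquivalence]

theorem map_comm_pushBraiding {A B : Center C} (f : A ⟶ B) (W : D) :
    F.map f.f ▷ W ≫ (pushBraiding F B.2 W).hom =
      (pushBraiding F A.2 W).hom ≫ W ◁ F.map f.f := by
  rw [← cancel_epi (F.obj A.1 ◁ (F.objObjPreimageIso W).hom), whisker_exchange_assoc,
    whiskerLeft_pushBraiding, reassoc_of% whiskerLeft_pushBraiding F _, ← whisker_exchange,
    reassoc_of% (map_comm_imageBraiding_iff F A.2 B.2 f.f _).2 (f.comm _)]

/-- The functor induced on Drinfeld centers by a monoidal equivalence. -/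
def mapCenter : Center C ⥤ Center D where
  obj A := ⟨F.obj A.1, pushHalfBraiding F A.2⟩
  map f := ⟨F.map f.f, map_comm_pushBraiding F f⟩
  map_id _ := Center.ext _ _ (F.map_id _)
  map_comp _ _ := Center.ext _ _ (F.map_comp _ _)

instance faithful_mapCenter : (mapCenter F).Faithful where
  map_injective h := Center.ext _ _ (F.map_injective (congrArg Center.Hom.f h))

instance full_mapCenter : (mapCenter F).Full where
  map_surjective {A B} g := by
    obtain ⟨f, hf⟩ := F.map_surjective g.f
    refine ⟨⟨f, fun U => (map_comm_imageBraiding_iff F A.2 B.2 f U).1 ?_⟩, Center.ext _ _ hf⟩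
    have h := g.comm (F.obj U)
    have hA := whiskerLeft_pushBraiding F A.2 (𝟙 (F.obj U))
    have hB := whiskerLeft_pushBraiding F B.2 (𝟙 (F.obj U))
    simp only [MonoidalCategory.whiskerLeft_id, id_whiskerRight, Category.id_comp,
      Category.comp_id] at hA hB
    rw [← hA, ← hB, hf]
    exact h

instance essSurj_mapCenter : (mapCenter F).EssSurj where
  mem_essImage := fun ⟨Y, c⟩ => by
    let i := F.objObjPreimageIso Y
    let b := pullHalfBraiding F (isoHalfBraiding c i)
    have hcomm (W : D) : i.hom ▷ W ≫ (c.β W).hom = (pushBraiding F b W).hom ≫ W ◁ i.hom := by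
      rw [← cancel_epi (F.obj _ ◁ (F.objObjPreimageIso W).hom),
        reassoc_of% whiskerLeft_pushBraiding F _, imageBraiding_pullHalfBraiding,
        whisker_exchange_assoc, c.naturality]
      simp [isoHalfBraiding, ← whisker_exchange]
    let f : (mapCenter F).obj ⟨_, b⟩ ⟶ ⟨Y, c⟩ := ⟨i.hom, hcomm⟩
    have : IsIso f.f := inferInstanceAs (IsIso i.hom)
    exact ⟨_, ⟨Center.isoMk f⟩⟩

instance isEquivalence_mapCenter : (mapCenter F).IsEquivalence where

instance additive_mapCenter [Preadditive C] [Preadditive D] [MonoidalPreadditive C]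
    [MonoidalPreadditive D] [F.Additive] : (mapCenter F).Additive where
  map_add := Center.ext _ _ F.map_add

instance linear_mapCenter {k : Type*} [Semiring k] [Preadditive C] [Preadditive D]
    [MonoidalPreadditive C] [MonoidalPreadditive D] [Linear k C] [Linear k D] [MonoidalLinear k C]
    [MonoidalLinear k D] [F.Linear k] : (mapCenter F).Linear k where
  map_smul f r := Center.ext _ _ (F.map_smul r f.f)

end MapCenter

end CenterFunctoriality

section RestrictScalars

variable {R S : Type u} [Ring R] [Ring S]

/-- Restriction of scalars along an isomorphism of rings. -/
def fgRestrictScalars (e : R ≃+* S) : FGModuleCat.{u} S ⥤ FGModuleCat.{u} R :=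
  (ModuleCat.isFG R).lift ((ModuleCat.isFG S).ι ⋙ ModuleCat.restrictScalars e.toRingHom)
    fun M =>
      have : Module.Finite S M := M.2
      letI : Module R M := Module.compHom M e.toRingHom
      Module.Finite.of_surjective (σ := (e.symm : S →+* R))
        { AddMonoidHom.id M with
          map_smul' := fun s m => congrArg (· • m) (e.apply_symm_apply s).symm }
        Function.surjective_id

instance faithful_fgRestrictScalars (e : R ≃+* S) : (fgRestrictScalars e).Faithful where
  map_injective h := FGModuleCat.hom_ext <| LinearMap.ext fun x =>
    congrArg (fun f => f.hom.hom x) h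

instance full_fgRestrictScalars (e : R ≃+* S) : (fgRestrictScalars e).Full where
  map_surjective {M N} f := by
    refine ⟨FGModuleCat.ofHom (V := M) (W := N) { f.hom.hom.toAddMonoidHom with
      map_smul' := fun s x => ?_ }, rfl⟩
    obtain ⟨r, rfl⟩ := e.surjective s
    exact f.hom.hom.map_smul r x

instance essSurj_fgRestrictScalars (e : R ≃+* S) : (fgRestrictScalars e).EssSurj where
  mem_essImage M := by
    let N := (fgRestrictScalars e.symm).obj M
    let e' : (fgRestrictScalars e).obj N ≃ₗ[R] M :=
      { AddEquiv.refl M with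
        map_smul' := fun r (m : M) => congrArg (· • m) (e.symm_apply_apply r) }
    exact ⟨N, ⟨e'.toFGModuleCatIso⟩⟩

instance isEquivalence_fgRestrictScalars (e : R ≃+* S) : (fgRestrictScalars e).IsEquivalence where

instance additive_fgRestrictScalars (e : R ≃+* S) : (fgRestrictScalars e).Additive where

open scoped ModuleCat in
instance linear_fgRestrictScalars {k : Type*} [Field k] [Algebra k R] [Algebra k S]
    (e : R ≃ₐ[k] S) : (fgRestrictScalars e.toRingEquiv).Linear k where
  map_smul {_ _} f r := FGModuleCat.hom_ext <| LinearMap.ext fun x =>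
    congrArg (· • f.hom.hom x) (e.commutes r).symm

end RestrictScalars

/-! ### Modules over `D_{T²}(G)` -/

section TorusDouble

variable (k G : Type u) [Field k] [Group G] [Fintype G]

instance instFiniteTorusDouble : Module.Finite k (TorusDouble k G) :=
  inferInstanceAs (Module.Finite k (torusSubalgebra k G).toSubmodule)

instance instIsNoetherianRingTorusDouble : IsNoetherianRing (TorusDouble k G) :=
  IsNoetherianRing.of_finite k _

variable {k G} in
theorem torusDouble_apply_eq_zero (b : TorusDouble k G) (g : ConjAct G) {p : G × G}
    (hp : p ∉ CommutingPairs G) : b.1 g p = 0 := by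
  classical
  rw [← mul_deltaOmega_of_mem k G b.2, deltaOmega_eq, ActionAlgebra.mul_ofFun, if_neg hp, mul_zero]

theorem torusDouble_one_apply (g : ConjAct G) (p : CommutingPairs G) :
    (1 : TorusDouble k G).1 g p.1 = (1 : ActionAlgebra k (ConjAct G) (CommutingPairs G)) g p := by
  classical
  change deltaOmega k G g p.1 = _
  rw [deltaOmega_eq, ActionAlgebra.one_def, ActionAlgebra.ofFun_apply, ActionAlgebra.ofFun_apply,
    if_pos p.2]

open Classical in
/-- The algebra `D_{T²}(G)` is the action algebra of `G` acting on the commuting pairs. -/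
def torusDoubleEquiv : TorusDouble k G ≃ₐ[k] ActionAlgebra k (ConjAct G) (CommutingPairs G) where
  toFun b := .mk fun g p => b.1 g p.1
  invFun a :=
    let b : EllipticDouble k G :=
      .mk fun g p => if hp : p ∈ CommutingPairs G then a g ⟨p, hp⟩ else 0
    ⟨b, b, ActionAlgebra.ext fun g p => by
      rw [deltaOmega_eq, ActionAlgebra.mul_ofFun]
      change dite _ _ _ = dite _ _ _ * _
      split_ifs <;> simp⟩
  left_inv b := Subtype.ext <| ActionAlgebra.ext fun g p => by
    change dite _ _ _ = _
    split_ifs with hp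
    · rfl
    · exact (torusDouble_apply_eq_zero b g hp).symm
  right_inv a := ActionAlgebra.ext fun g p => dif_pos p.2
  map_mul' _ _ := rfl
  map_add' _ _ := rfl
  commutes' r := ActionAlgebra.ext fun g p => by
    rw [Algebra.algebraMap_eq_smul_one, Algebra.algebraMap_eq_smul_one, ActionAlgebra.smul_apply,
      ← torusDouble_one_apply]
    rfl

/-- Modules over `D_{T²}(G)` as equivariant bundles over the commuting pairs. -/
def torusToBundle :
    FGModuleCat.{u} (TorusDouble k G) ⥤ EquivariantBundle k (ConjAct G) (CommutingPairs G) :=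
  fgRestrictScalars (torusDoubleEquiv k G).symm.toRingEquiv ⋙
    ActionAlgebra.toBundle k (ConjAct G) (CommutingPairs G)

instance isEquivalence_torusToBundle : (torusToBundle k G).IsEquivalence :=
  letI : Fintype (CommutingPairs G) := Fintype.ofFinite _
  inferInstanceAs (fgRestrictScalars _ ⋙ ActionAlgebra.toBundle k _ _).IsEquivalence

instance additive_torusToBundle : (torusToBundle k G).Additive :=
  inferInstanceAs (fgRestrictScalars _ ⋙ ActionAlgebra.toBundle k _ _).Additive

instance linear_torusToBundle : (torusToBundle k G).Linear k :=
  inferInstanceAs ((fgRestrictScalars (torusDoubleEquiv k G).symm.toRingEquiv ⋙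
    ActionAlgebra.toBundle k _ _).Linear k)

end TorusDouble

section PairLoop

open ActionAlgebra

-- The morphisms are those of the groupoid structure, since `ActionCategory` carries a second,
-- only definitionally equal, category structure.
instance finite_actionCategory_hom {H X : Type u} [Group H] [Finite H] [MulAction H X]
    (p q : ActionCategory H X) :
    Finite ((Groupoid.toCategory (obj := ActionCategory H X)).Hom p q) :=
  inferInstanceAs (Finite {h : H // h • p.back = q.back})

variable (G : Type u) [Group G]

variable {G} in
theorem conjAct_smul_eq_iff {a : ConjAct G} {g h : G} :
    a • g = h ↔ a * ConjAct.toConjAct g = ConjAct.toConjAct h * a :=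
  mul_inv_eq_iff_eq_mul

/-- The commuting pair `(g, h)` as the loop labelled `h` at `g` in the action groupoid of the
conjugation action. -/
def pairLoop : ActionCategory (ConjAct G) (CommutingPairs G) ⥤
    LoopGroupoid (ActionCategory (ConjAct G) G) where
  obj p := ⟨pt _ p.back.1.1,
    arrow (ConjAct.toConjAct p.back.1.2) (conjAct_smul_eq_iff.2 p.back.2.symm)⟩
  map f := ⟨arrow (label f) (congrArg (fun r : CommutingPairs G => r.1.1) (label_smul f)),
    Subtype.ext <| conjAct_smul_eq_iff.1 <|
      congrArg (fun r : CommutingPairs G => r.1.2) (label_smul f)⟩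
  map_id _ := rfl
  map_comp _ _ := rfl

instance faithful_pairLoop : (pairLoop G).Faithful where
  map_injective h := Subtype.ext (congrArg (fun f => f.1.1) h)

instance full_pairLoop : (pairLoop G).Full where
  map_surjective f :=
    ⟨⟨f.1.1, Subtype.ext <| Prod.ext f.1.2 <| conjAct_smul_eq_iff.2 (congrArg Subtype.val f.2)⟩,
      rfl⟩

instance essSurj_pairLoop : (pairLoop G).EssSurj where
  mem_essImage := fun ⟨⟨_, g⟩, ⟨h, hγ⟩⟩ =>
    ⟨pt _ ⟨(g, ConjAct.ofConjAct h), (conjAct_smul_eq_iff (G := G).1 hγ).symm⟩, ⟨Iso.refl _⟩⟩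

instance isEquivalence_pairLoop : (pairLoop G).IsEquivalence where

end PairLoop

section Inverse

variable {C D : Type*} [Category* C] [Category* D] [Preadditive C] [Preadditive D] (F : C ⥤ D)
  [F.IsEquivalence] [F.Additive]

instance additive_inv : F.inv.Additive :=
  have : F.asEquivalence.functor.Additive := ‹_›
  inferInstanceAs F.asEquivalence.inverse.Additive

instance linear_inv {k : Type*} [Semiring k] [Linear k C] [Linear k D] [F.Linear k] :
    F.inv.Linear k :=
  have : F.asEquivalence.functor.Additive := ‹_›
  have : F.asEquivalence.functor.Linear k := ‹_›
  inferInstanceAs (F.asEquivalence.inverse.Linear k)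

end Inverse

section CenterToTorus

variable (k G : Type u) [Field k] [Group G] [Fintype G]

/-- Bundles over loops in the action groupoid of the conjugation action as equivariant bundles over
the commuting pairs. -/
def loopToPair : GroupoidBundle k (LoopGroupoid (ActionCategory (ConjAct G) G)) ⥤
    EquivariantBundle k (ConjAct G) (CommutingPairs G) :=
  (Functor.whiskeringLeft _ _ _).obj (pairLoop G)

instance isEquivalence_loopToPair : (loopToPair k G).IsEquivalence :=
  inferInstanceAs ((pairLoop G).asEquivalence.congrLeft.inverse).IsEquivalence

instance additive_loopToPair : (loopToPair k G).Additive where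

instance linear_loopToPair : (loopToPair k G).Linear k where

/-- Bundles over loops in the action groupoid of the conjugation action as central equivariant
bundles. -/
def loopToCenter : GroupoidBundle k (LoopGroupoid (ActionCategory (ConjAct G) G)) ⥤
    Center (EquivariantBundle k (ConjAct G) G) :=
  GroupoidBundle.loopTotal k (ActionCategory (ConjAct G) G)

instance isEquivalence_loopToCenter : (loopToCenter k G).IsEquivalence :=
  GroupoidBundle.isEquivalence_loopTotal

instance additive_loopToCenter : (loopToCenter k G).Additive :=
  GroupoidBundle.additive_loopTotal

instance linear_loopToCenter : (loopToCenter k G).Linear k :=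
  GroupoidBundle.linear_loopTotal

/-- The functor from the center of the modules over the Drinfeld double to the modules over
`D_{T²}(G)`. -/
def centerToTorus :
    Center (FGModuleCat.{u} (DrinfeldDouble k G)) ⥤ FGModuleCat.{u} (TorusDouble k G) :=
  mapCenter (ActionAlgebra.toBundle k (ConjAct G) G) ⋙ (loopToCenter k G).inv ⋙
    loopToPair k G ⋙ (torusToBundle k G).inv

instance isEquivalence_centerToTorus : (centerToTorus k G).IsEquivalence := by
  unfold centerToTorus; infer_instance

instance additive_centerToTorus : (centerToTorus k G).Additive := by
  unfold centerToTorus; infer_instance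

instance linear_centerToTorus : (centerToTorus k G).Linear k := by
  unfold centerToTorus; infer_instance

end CenterToTorus

theorem theoremt_general (k G : Type u) [Field k] [Group G] [Fintype G] :
    IsAbelianCategory (Center (FGModuleCat.{u} (DrinfeldDouble k G))) ∧
    IsAbelianCategory (FGModuleCat.{u} (TorusDouble k G)) ∧
    (∃ F : Center (FGModuleCat.{u} (DrinfeldDouble k G)) ⥤ FGModuleCat.{u} (TorusDouble k G),
      F.IsEquivalence ∧ F.Additive ∧ F.Linear k) ∧
    (∃ E : FGModuleCat.{u} (TorusDouble k G) ⥤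
        EquivariantBundle k (ConjAct G) (CommutingPairs G),
      E.IsEquivalence ∧ E.Additive ∧ E.Linear k) :=
  ⟨isAbelianCategory_of_isEquivalence (centerToTorus k G), ⟨inferInstance, rfl⟩,
    ⟨centerToTorus k G, inferInstance, inferInstance, inferInstance⟩,
    ⟨torusToBundle k G, inferInstance, inferInstance, inferInstance⟩⟩

end

/-- For a finite group `G` and an algebraically closed field `k` of characteristic zero, the
Drinfeld center of `D(G)`-modules with the fibrewise tensor product is equivalent, as a `k`-linear
abelian category, to the modules over `D_{T²}(G)`, which are the `G`-equivariant bundles over the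
set of commuting pairs. -/
theorem theoremt (k G : Type u) [Field k] [IsAlgClosed k] [CharZero k] [Group G] [Fintype G] :
    IsAbelianCategory (Center (FGModuleCat.{u} (DrinfeldDouble k G))) ∧
    IsAbelianCategory (FGModuleCat.{u} (TorusDouble k G)) ∧
    (∃ F : Center (FGModuleCat.{u} (DrinfeldDouble k G)) ⥤ FGModuleCat.{u} (TorusDouble k G),
      F.IsEquivalence ∧ F.Additive ∧ F.Linear k) ∧
    (∃ E : FGModuleCat.{u} (TorusDouble k G) ⥤
        EquivariantBundle k (ConjAct G) (CommutingPairs G),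
      E.IsEquivalence ∧ E.Additive ∧ E.Linear k) :=
  theoremt_general k G
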